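/- Let $(\Omega,\mathcal F,\mathbb P)$ be an atomless probability space, $\mathcal L^\infty$ the set of bounded random variables, $\mathcal L_1$ the set of $[0,1]$-valued random variables, and $S=(S_1,\dots,S_s)$, $s\ge 1$, a partition of $\Omega$ into events of positive probability; write $\mathbb P_j=\mathbb P(\cdot\mid S_j)$ and $\mathbb P^S=(\mathbb P_1,\dots,\mathbb P_s)$. "Increasing" is meant in the non-strict sense. A capacity is an increasing $\nu:\mathcal F\to\mathbb R$ with $\nu(\varnothing)=0$, $\nu(\Omega)=1$; the Choquet integral is $\int X\,d\nu=\int_0^\infty \nu(X>x)\,dx+\int_{-\infty}^0(\nu(X>x)-1)\,dx$, and a Choquet risk measure is a map $\rho:\mathcal L^\infty\to\mathbb R$, $\rho(X)=\int X\,d\nu$, for some capacity $\nu$. Let $n\ge 2$ and let $\mathcal I:\mathcal L_1\to\{1,\dots,n\}$ be a Choquet rating criterion, i.e. $\mathcal I$ is increasing and $\mathcal I(X)=f(\rho_{\mathcal I}(X))$ for all $X\in\mathcal L_1$, where $\rho_{\mathcal I}$ is a Choquet risk measure and $f:[0,1]\to\{1,\dots,n\}$ is increasing with $f(0)=1$,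 $f(1)=n$ and is not constant on $(0,1)$. Assume that $\mathcal I$ is $S$-law invariant ($\mathcal I(X)=\mathcal I(Y)$ whenever $X,Y\in\mathcal L_1$ have the same distribution under each $\mathbb P_j$), and that $\rho_{\mathcal I}$ is Lebesgue continuous ($\rho_{\mathcal I}(X_\ell)\to\rho_{\mathcal I}(X)$ whenever $(X_\ell)$ is a bounded sequence in $\mathcal L^\infty$ converging almost surely to $X\in\mathcal L^\infty$). Then the following are equivalent. (i) [QC] $\mathcal I(\lambda X+(1-\lambda)Y)\le\max\{\mathcal I(X),\mathcal I(Y)\}$ for all $X,Y\in\mathcal L_1$, $\lambda\in[0,1]$. (ii) [$S$-RA] $\mathcal I(X)\le\mathcal I(Y)$ for all $X,Y\in\mathcal L_1$ such that $\mathbb E^{\mathbb P_j}[\phi(X)]\le\mathbb E^{\mathbb P_j}[\phi(Y)]$ for every $j$ and every increasing convex $\phi:\mathbb R\to\mathbb R$. (iii) [$S$-PE] For every sequence $(L_\ell)_{\ell\ge1}$ in $\mathcal L_1$ that is, under each $\mathbb P_j$, conditionally iid given some random vector (which may depend on $j$), all $1\le\ell\le\ell'$ and all $K\in[0,1)$,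 $$\mathcal I\left(\frac{(L^{(\ell)}-K)_+}{1-K}\right)\ge\mathcal I\left(\frac{(L^{(\ell')}-K)_+}{1-K}\right),\qquad L^{(\ell)}=\frac{L_1+\dots+L_\ell}{\ell}.$$ (iv) $\rho_{\mathcal I}$ has a componentwise concave and submodular $S$-distortion function: there is a componentwise increasing $g:[0,1]^s\to\mathbb R$ with $g(0,\dots,0)=0$, $g(1,\dots,1)=1$ such that $\rho_{\mathcal I}(X)=\int X\,d(g\circ\mathbb P^S)$ for all $X\in\mathcal L^\infty$, $g$ is concave in each coordinate, and $g(\mathbf x\wedge\mathbf y)+g(\mathbf x\vee\mathbf y)\le g(\mathbf x)+g(\mathbf y)$ for all $\mathbf x,\mathbf y\in[0,1]^s$ (componentwise minimum and maximum). -/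

import Mathlib

open MeasureTheory ProbabilityTheory
open scoped ENNReal

namespace ChoquetRating

noncomputable section

/-- A measure is atomless: every event of positive measure contains an event of strictly smaller
positive measure. (Mathlib's `NoAtoms` only says that singletons are null.) -/
def IsAtomless {Ω : Type*} [MeasurableSpace Ω] (P : Measure Ω) : Prop :=
  ∀ A : Set Ω, MeasurableSet A → 0 < P A →
    ∃ B : Set Ω, MeasurableSet B ∧ B ⊆ A ∧ 0 < P B ∧ P B < P A

/-- Bounded random variables. -/
def BddRV (Ω : Type*) [MeasurableSpace Ω] : Type _ :=
  {X : Ω → ℝ // Measurable X ∧ ∃ M : ℝ, ∀ ω, |X ω| ≤ M}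

/-- Losses: random variables with values in `[0,1]`. -/
def Loss (Ω : Type*) [MeasurableSpace Ω] : Type _ :=
  {X : Ω → ℝ // Measurable X ∧ ∀ ω, X ω ∈ Set.Icc (0 : ℝ) 1}

instance {Ω : Type*} [MeasurableSpace Ω] : CoeFun (BddRV Ω) (fun _ => Ω → ℝ) := ⟨Subtype.val⟩

instance {Ω : Type*} [MeasurableSpace Ω] : CoeFun (Loss Ω) (fun _ => Ω → ℝ) := ⟨Subtype.val⟩

section losses

variable {Ω : Type*} [MeasurableSpace Ω]

/-- A loss, seen as a bounded random variable. -/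
def Loss.toBdd (X : Loss Ω) : BddRV Ω :=
  ⟨X.1, X.2.1, 1, fun ω => abs_le.2 ⟨by linarith [(X.2.2 ω).1], (X.2.2 ω).2⟩⟩

/-- The convex combination `t X + (1 - t) Y` of two losses. -/
def Loss.mix (t : ℝ) (ht : t ∈ Set.Icc (0 : ℝ) 1) (X Y : Loss Ω) : Loss Ω :=
  ⟨fun ω => t * X ω + (1 - t) * Y ω,
    (X.2.1.const_mul t).add (Y.2.1.const_mul (1 - t)), fun ω => by
      obtain ⟨h0, h1⟩ := ht
      obtain ⟨a0, a1⟩ := X.2.2 ω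
      obtain ⟨b0, b1⟩ := Y.2.2 ω
      constructor
      · exact add_nonneg (mul_nonneg h0 a0) (mul_nonneg (by linarith) b0)
      · nlinarith [mul_le_mul_of_nonneg_left a1 h0,
          mul_le_mul_of_nonneg_left b1 (sub_nonneg.2 h1)]⟩

/-- The pool loss `(L 0 + ⋯ + L (ℓ - 1)) / ℓ` (used for `ℓ ≥ 1`). -/
def Loss.pool (L : ℕ → Loss Ω) (ℓ : ℕ) : Loss Ω :=
  ⟨fun ω => (∑ i ∈ Finset.range ℓ, L i ω) / (ℓ : ℝ),
    (Finset.measurable_fun_sum _ fun i _ => (L i).2.1).div_const _, fun ω => by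
      constructor
      · exact div_nonneg (Finset.sum_nonneg fun i _ => ((L i).2.2 ω).1) (Nat.cast_nonneg _)
      · refine div_le_one_of_le₀ ?_ (Nat.cast_nonneg _)
        calc ∑ i ∈ Finset.range ℓ, L i ω ≤ ∑ _i ∈ Finset.range ℓ, (1 : ℝ) :=
              Finset.sum_le_sum fun i _ => ((L i).2.2 ω).2
          _ = (ℓ : ℝ) := by simp⟩

/-- The normalized senior tranche `(X - K)₊ / (1 - K)` with attachment point `K ∈ [0,1)`. -/
def Loss.tranche (K : ℝ) (hK : K ∈ Set.Ico (0 : ℝ) 1) (X : Loss Ω) : Loss Ω :=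
  ⟨fun ω => max (X ω - K) 0 / (1 - K),
    ((X.2.1.sub_const K).max measurable_const).div_const _, fun ω => by
      obtain ⟨h0, h1⟩ := hK
      obtain ⟨a0, a1⟩ := X.2.2 ω
      constructor
      · exact div_nonneg (le_max_right _ _) (by linarith)
      · exact div_le_one_of_le₀ (max_le (by linarith) (by linarith)) (by linarith)⟩

end losses

section choquet

variable {Ω : Type*} [MeasurableSpace Ω]

/-- Capacities: normalized increasing set functions on the σ-algebra. The values of `ν` on
non-measurable sets are irrelevant. -/
structure IsCapacity (ν : Set Ω → ℝ) : Prop where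
  empty : ν ∅ = 0
  univ : ν Set.univ = 1
  mono : ∀ A B : Set Ω, MeasurableSet A → MeasurableSet B → A ⊆ B → ν A ≤ ν B

/-- The Choquet integral `∫_0^∞ ν(X > x) dx + ∫_{-∞}^0 (ν(X > x) - 1) dx`. -/
def choquet (ν : Set Ω → ℝ) (X : BddRV Ω) : ℝ :=
  (∫ x in Set.Ioi (0 : ℝ), ν {ω | x < X ω}) + ∫ x in Set.Iio (0 : ℝ), (ν {ω | x < X ω} - 1)

/-- Choquet risk measures on the bounded random variables. -/
def IsChoquetRiskMeasure (ρ : BddRV Ω → ℝ) : Prop :=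
  ∃ ν : Set Ω → ℝ, IsCapacity ν ∧ ∀ X, ρ X = choquet ν X

/-- Lebesgue continuity [LC]: convergence along bounded almost surely convergent sequences. -/
def LebesgueContinuous (P : Measure Ω) (ρ : BddRV Ω → ℝ) : Prop :=
  ∀ (X : ℕ → BddRV Ω) (Y : BddRV Ω), (∃ M : ℝ, ∀ ℓ ω, |X ℓ ω| ≤ M) →
    (∀ᵐ ω ∂P, Filter.Tendsto (fun ℓ => X ℓ ω) Filter.atTop (nhds (Y ω))) →
    Filter.Tendsto (fun ℓ => ρ (X ℓ)) Filter.atTop (nhds (ρ Y))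

end choquet

section rating

variable {Ω : Type*} [MeasurableSpace Ω]

/-- Rating criteria with the `n` categories `1, …, n`. -/
structure RatingCriterion (Ω : Type*) [MeasurableSpace Ω] (n : ℕ) where
  rate : Loss Ω → ℕ
  mem_range : ∀ X, rate X ∈ Set.Icc 1 n
  mono : ∀ X Y : Loss Ω, (∀ ω, X ω ≤ Y ω) → rate X ≤ rate Y

/-- `ρ` is a Choquet risk measure that represents `I`, through some increasing
`f : [0,1] → {1, …, n}` with `f 0 = 1`, `f 1 = n` that is not constant on `(0,1)`. There is at most
one such `ρ`. Only the values of `f` on `[0,1]` matter. -/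
def IsChoquetRepresentation {n : ℕ} (I : RatingCriterion Ω n) (ρ : BddRV Ω → ℝ) : Prop :=
  IsChoquetRiskMeasure ρ ∧
    ∃ f : ℝ → ℕ, Set.MapsTo f (Set.Icc 0 1) (Set.Icc 1 n) ∧ MonotoneOn f (Set.Icc 0 1) ∧
      f 0 = 1 ∧ f 1 = n ∧
      (∃ x ∈ Set.Ioo (0 : ℝ) 1, ∃ y ∈ Set.Ioo (0 : ℝ) 1, f x ≠ f y) ∧
      ∀ X : Loss Ω, I.rate X = f (ρ X.toBdd)

/-- Quasi-convexity [QC]. -/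
def QuasiConvex {n : ℕ} (I : RatingCriterion Ω n) : Prop :=
  ∀ (X Y : Loss Ω) (t : ℝ) (ht : t ∈ Set.Icc (0 : ℝ) 1),
    I.rate (Loss.mix t ht X Y) ≤ max (I.rate X) (I.rate Y)

end rating

section scenarios

variable {Ω : Type*} [MeasurableSpace Ω] {s : ℕ}

/-- A collection of scenarios: disjoint events of positive probability that cover `Ω`. -/
structure IsScenarios (P : Measure Ω) (S : Fin s → Set Ω) : Prop where
  measurable : ∀ j, MeasurableSet (S j)
  disjoint : ∀ i j, i ≠ j → Disjoint (S i) (S j)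
  pos : ∀ j, P (S j) ≠ 0
  cover : ⋃ j, S j = Set.univ

/-- The vector `(P(A | S j))_j` of scenario probabilities of an event. -/
def scenarioProb (P : Measure Ω) (S : Fin s → Set Ω) (A : Set Ω) : Fin s → ℝ :=
  fun j => (cond P (S j)).real A

/-- `S`-law invariance [`S`-LI]. -/
def SLawInvariant {n : ℕ} (P : Measure Ω) (S : Fin s → Set Ω) (I : RatingCriterion Ω n) : Prop :=
  ∀ X Y : Loss Ω, (∀ j, IdentDistrib (X : Ω → ℝ) (Y : Ω → ℝ) (cond P (S j)) (cond P (S j))) →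
    I.rate X = I.rate Y

/-- The increasing convex order `X ≤_icx Y` under the probability `Q`. -/
def IcxLE (Q : Measure Ω) (X Y : Loss Ω) : Prop :=
  ∀ φ : ℝ → ℝ, Monotone φ → ConvexOn ℝ Set.univ φ → ∫ ω, φ (X ω) ∂Q ≤ ∫ ω, φ (Y ω) ∂Q

/-- `S`-risk aversion consistency [`S`-RA]. -/
def SRiskAverse {n : ℕ} (P : Measure Ω) (S : Fin s → Set Ω) (I : RatingCriterion Ω n) : Prop :=
  ∀ X Y : Loss Ω, (∀ j, IcxLE (cond P (S j)) X Y) → I.rate X ≤ I.rate Y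

/-- The sequence `L` is conditionally iid under `Q`: there is a random vector `Z` such that, given
`Z`, the `L i` are independent (joint conditional probabilities factorize) and identically
distributed. -/
def IsCondIID (Q : Measure Ω) (L : ℕ → Loss Ω) : Prop :=
  ∃ (d : ℕ) (Z : Ω → (Fin d → ℝ)), Measurable Z ∧
    (∀ (F : Finset ℕ) (B : ℕ → Set ℝ), (∀ i, MeasurableSet (B i)) →
      Q⟦⋂ i ∈ F, (L i : Ω → ℝ) ⁻¹' B i | MeasurableSpace.comap Z inferInstance⟧ =ᵐ[Q]
        ∏ i ∈ F, Q⟦(L i : Ω → ℝ) ⁻¹' B i | MeasurableSpace.comap Z inferInstance⟧) ∧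
    ∀ (i k : ℕ) (B : Set ℝ), MeasurableSet B →
      Q⟦(L i : Ω → ℝ) ⁻¹' B | MeasurableSpace.comap Z inferInstance⟧ =ᵐ[Q]
        Q⟦(L k : Ω → ℝ) ⁻¹' B | MeasurableSpace.comap Z inferInstance⟧

/-- `S`-pooling effect consistency [`S`-PE]. The conditioning vector may depend on the scenario. -/
def SPoolingEffect {n : ℕ} (P : Measure Ω) (S : Fin s → Set Ω) (I : RatingCriterion Ω n) : Prop :=
  ∀ L : ℕ → Loss Ω, (∀ j, IsCondIID (cond P (S j)) L) →
    ∀ ℓ ℓ' : ℕ, 1 ≤ ℓ → ℓ ≤ ℓ' → ∀ (K : ℝ) (hK : K ∈ Set.Ico (0 : ℝ) 1),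
      I.rate (Loss.tranche K hK (Loss.pool L ℓ')) ≤ I.rate (Loss.tranche K hK (Loss.pool L ℓ))

/-- `g` is an `S`-distortion function of `ρ`: `g : [0,1]^s → ℝ` is increasing with `g 0 = 0`,
`g 1 = 1`, and `ρ` is the Choquet integral with respect to `A ↦ g (P(A | S j))_j`. Only the values
of `g` on `[0,1]^s` matter. -/
structure IsSDistortionFunction (P : Measure Ω) (S : Fin s → Set Ω) (ρ : BddRV Ω → ℝ)
    (g : (Fin s → ℝ) → ℝ) : Prop where
  mono : MonotoneOn g (Set.Icc 0 1)
  zero : g 0 = 0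
  one : g 1 = 1
  repr : ∀ X : BddRV Ω, ρ X = choquet (fun A => g (scenarioProb P S A)) X

/-- Concavity in each coordinate on `[0,1]^s`. -/
def ComponentwiseConcave (g : (Fin s → ℝ) → ℝ) : Prop :=
  ∀ x ∈ Set.Icc (0 : Fin s → ℝ) 1, ∀ j : Fin s,
    ConcaveOn ℝ (Set.Icc (0 : ℝ) 1) (fun t => g (Function.update x j t))

/-- Submodularity on `[0,1]^s`; `⊓` and `⊔` are componentwise minimum and maximum. -/
def Submodular (g : (Fin s → ℝ) → ℝ) : Prop :=
  ∀ x ∈ Set.Icc (0 : Fin s → ℝ) 1, ∀ y ∈ Set.Icc (0 : Fin s → ℝ) 1,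
    g (x ⊓ y) + g (x ⊔ y) ≤ g x + g y

end scenarios

end

end ChoquetRating

open ChoquetRating

/-! A rating only records on which side of some level `c` a risk lies, yet it determines the order
of the risks: increasing affine maps commute with the Choquet integral, so two distinct risks can be
moved to opposite sides of `c` (`exists_threshold`, `rho_le_of_rate_affine_le`). Thus conditions on
`I` become conditions on `ρ`. `S`-law invariance makes the capacity `ν` a function of the scenario
probabilities. Since the scenarios are atomless, there is a `U` that is uniform in each of them, and
the increasing family `hS.lower U x` realises every vector `x` of the cube. Hence `g x = ν (hS.lower
U x)` is a distortion function, and Lebesgue continuity makes it continuous.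

Condition (iv) is reduced to the local inequality `LocallyDecreasing`: if `y ≤ x`, the increment of
`g` at `x` over `[t, t + d]` in coordinate `j` is at most its increment at `y` over `[t - d, t]`.
The case `x = y` is midpoint concavity; summing over small steps gives decreasing differences, and
these together with concavity give submodularity. Under (i) the capacity is submodular, and the
inequality is its submodularity for suitable events. Under (iii) it comes from pooling two losses
driven by fair coins in scenario `j` only: one coin, the union and the intersection of two coins
have probabilities 1/2, 3/4, 1/4, which produces the arguments `t`, `t + d`, `t - d`.

Conversely, (iv) makes `ν` submodular, so the Choquet integral is convex (`choquet_mix_le`) and (i)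
follows. For (ii), the risk is the integral of `g` along the decreasing curve of survival
probabilities. One coordinate is exchanged at a time; the supergradients of `g` along the curve form
an increasing weight, against which the ordering of tail integrals given by the increasing convex
order is preserved (`integral_curve_le`). Finally (ii) implies (iii) because a pool is the average
of its leave-one-out pools, which are equally distributed, so that Jensen's inequality applies. -/

open ChoquetRating

namespace ChoquetRating

/-! ### Atomless measures: intermediate values and prescribed laws. -/

section Atomless

variable {Ω : Type*} [MeasurableSpace Ω] {P : Measure Ω}

theorem IsAtomless.exists_le_half_pow [IsFiniteMeasure P] (hP : IsAtomless P) {A : Set Ω}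
    (hA : MeasurableSet A) (hA0 : 0 < P A) (n : ℕ) :
    ∃ B ⊆ A, MeasurableSet B ∧ 0 < P B ∧ P.real B ≤ (1 / 2) ^ n * P.real A := by
  induction n with
  | zero => exact ⟨A, subset_rfl, hA, hA0, by simp⟩
  | succ n ih =>
    obtain ⟨B, hBA, hB, hB0, hBn⟩ := ih
    obtain ⟨C, hC, hCB, hC0, hC1⟩ := hP B hB hB0
    have hsum : P.real C + P.real (B \ C) = P.real B := by
      rw [measureReal_sdiff hCB hC]; ring
    have hD0 : 0 < P (B \ C) := by
      rw [measure_sdiff hCB hC.nullMeasurableSet (measure_ne_top _ _)]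
      exact tsub_pos_of_lt hC1
    rcases le_total (P.real C) (P.real (B \ C)) with h | h
    · refine ⟨C, hCB.trans hBA, hC, hC0, ?_⟩
      rw [pow_succ]; linarith
    · refine ⟨B \ C, Set.sdiff_subset.trans hBA, hB.diff hC, hD0, ?_⟩
      rw [pow_succ]; linarith

theorem IsAtomless.exists_lt [IsFiniteMeasure P] (hP : IsAtomless P) {A : Set Ω}
    (hA : MeasurableSet A) (hA0 : 0 < P A) {ε : ℝ} (hε : 0 < ε) :
    ∃ B ⊆ A, MeasurableSet B ∧ 0 < P B ∧ P.real B < ε := by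
  have : Filter.Tendsto (fun n : ℕ => (1 / 2 : ℝ) ^ n * P.real A) Filter.atTop (nhds (0 * P.real A)) :=
    (tendsto_pow_atTop_nhds_zero_of_lt_one (by norm_num) (by norm_num)).mul_const _
  rw [zero_mul] at this
  obtain ⟨n, hn⟩ := (this.eventually_lt_const hε).exists
  obtain ⟨B, h1, h2, h3, h4⟩ := hP.exists_le_half_pow hA hA0 n
  exact ⟨B, h1, h2, h3, h4.trans_lt hn⟩

/-- Sierpinski: the values of an atomless measure fill an interval. -/
theorem IsAtomless.exists_subset_measureReal_eq [IsFiniteMeasure P] (hP : IsAtomless P) {A : Set Ω}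
    (hA : MeasurableSet A) {t : ℝ} (ht0 : 0 ≤ t) (ht : t ≤ P.real A) :
    ∃ B ⊆ A, MeasurableSet B ∧ P.real B = t := by
  let T := {B : Set Ω // B ⊆ A ∧ MeasurableSet B ∧ P.real B ≤ t}
  -- Greedy exhaustion: `B'` gains at least half of what any admissible extension of `B` can gain.
  have step : ∀ B : T, ∃ B' : T, B.1 ⊆ B'.1 ∧ ∀ D : T, B.1 ⊆ D.1 →
      P.real D.1 ≤ 2 * P.real B'.1 - P.real B.1 := by
    intro B
    let R : Set ℝ := (fun D : T => P.real D.1) '' {D | B.1 ⊆ D.1}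
    have hR : BddAbove R := ⟨t, by rintro _ ⟨D, -, rfl⟩; exact D.2.2.2⟩
    have hBR : P.real B.1 ∈ R := ⟨B, Set.Subset.refl B.1, rfl⟩
    have hle : P.real B.1 ≤ sSup R := le_csSup hR hBR
    rcases hle.eq_or_lt with h | h
    · refine ⟨B, subset_rfl, fun D hD => ?_⟩
      have : P.real D.1 ≤ sSup R := le_csSup hR ⟨D, hD, rfl⟩
      linarith
    · obtain ⟨_, ⟨B', hB', rfl⟩, hlt⟩ := exists_lt_of_lt_csSup ⟨_, hBR⟩
        (show (sSup R + P.real B.1) / 2 < sSup R by linarith)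
      refine ⟨B', hB', fun D hD => ?_⟩
      have : P.real D.1 ≤ sSup R := le_csSup hR ⟨D, hD, rfl⟩
      simp only at hlt
      linarith
  choose F hF1 hF2 using step
  let B : ℕ → T := fun n => F^[n] ⟨∅, Set.empty_subset _, MeasurableSet.empty, by simpa using ht0⟩
  have hBs : ∀ n, B (n + 1) = F (B n) := fun n => Function.iterate_succ_apply' F n _
  have hmono : Monotone fun n => (B n).1 := monotone_nat_of_le_succ fun n => by
    rw [hBs]; exact hF1 _
  have hlim : Filter.Tendsto (fun n => P.real (B n).1) Filter.atTop
      (nhds (P.real (⋃ n, (B n).1))) :=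
    (ENNReal.tendsto_toReal (measure_ne_top _ _)).comp (tendsto_measure_iUnion_atTop hmono)
  have hmU : MeasurableSet (⋃ n, (B n).1) := MeasurableSet.iUnion fun n => (B n).2.2.1
  have hUA : (⋃ n, (B n).1) ⊆ A := Set.iUnion_subset fun n => (B n).2.1
  have hUt : P.real (⋃ n, (B n).1) ≤ t := le_of_tendsto' hlim fun n => (B n).2.2.2
  refine ⟨_, hUA, hmU, hUt.antisymm ?_⟩
  by_contra! hlt
  have hpos : 0 < P (A \ ⋃ n, (B n).1) := by
    rw [measure_sdiff hUA hmU.nullMeasurableSet (measure_ne_top _ _), tsub_pos_iff_lt]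
    exact (ENNReal.toReal_lt_toReal (measure_ne_top _ _) (measure_ne_top _ _)).1
      (hlt.trans_le ht)
  obtain ⟨D, hDA, hD, hD0, hDt⟩ := hP.exists_lt (hA.diff hmU) hpos (sub_pos.2 hlt)
  have hdisj : Disjoint (⋃ n, (B n).1) D := by
    rw [Set.disjoint_left]; intro ω h1 h2; exact (hDA h2).2 h1
  have hun : P.real ((⋃ n, (B n).1) ∪ D) = P.real (⋃ n, (B n).1) + P.real D :=
    measureReal_union hdisj hD
  let D' : T := ⟨(⋃ n, (B n).1) ∪ D, Set.union_subset hUA (hDA.trans Set.sdiff_subset),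
    hmU.union hD, by rw [hun]; linarith⟩
  have hlim2 : Filter.Tendsto (fun n => 2 * P.real (B (n + 1)).1 - P.real (B n).1) Filter.atTop
      (nhds (2 * P.real (⋃ n, (B n).1) - P.real (⋃ n, (B n).1))) :=
    ((hlim.comp (Filter.tendsto_add_atTop_nat 1)).const_mul 2).sub hlim
  -- The gains tend to zero, so no admissible set can exceed the union in measure; but `D'` does.
  have := ge_of_tendsto' hlim2 (b := P.real D'.1) fun n => by
    rw [hBs]
    exact hF2 _ D' ((Set.subset_iUnion (fun n => (B n).1) n).trans Set.subset_union_left)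
  have hDr : 0 < P.real D := ENNReal.toReal_pos hD0.ne' (measure_ne_top _ _)
  change P.real ((⋃ n, (B n).1) ∪ D) ≤ _ at this
  linarith

theorem IsAtomless.cond [IsFiniteMeasure P] (hP : IsAtomless P) {S : Set Ω} (hS : MeasurableSet S) :
    IsAtomless (ProbabilityTheory.cond P S) := by
  intro A hA hA0
  have hc : ∀ B, ProbabilityTheory.cond P S B = (P S)⁻¹ * P (S ∩ B) := fun B => cond_apply hS P B
  rw [hc] at hA0
  have h0 : P (S ∩ A) ≠ 0 := fun h => by simp [h] at hA0
  obtain ⟨B, hB, hBA, hB0, hB1⟩ := hP (S ∩ A) (hS.inter hA) (pos_iff_ne_zero.2 h0)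
  have hSB : S ∩ B = B := Set.inter_eq_right.2 fun ω h => (hBA h).1
  have hS0 : P S ≠ 0 := fun h => h0 (measure_mono_null Set.inter_subset_left h)
  refine ⟨B, hB, fun ω h => (hBA h).2, ?_, ?_⟩
  · rw [hc, hSB]
    exact ENNReal.mul_pos (ENNReal.inv_ne_zero.2 (measure_ne_top _ _)) hB0.ne'
  · rw [hc, hc, hSB]
    exact ENNReal.mul_lt_mul_right (ENNReal.inv_ne_zero.2 (measure_ne_top _ _))
      (ENNReal.inv_ne_top.2 hS0) hB1

/-- An atomless probability space carries a random variable with values in a standard Borel space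
whose law charges no point. -/
theorem IsAtomless.exists_measurable_noAtoms [IsProbabilityMeasure P] (hP : IsAtomless P) :
    ∃ X : Ω → (ℕ → Bool), Measurable X ∧ ∀ w, P (X ⁻¹' {w}) = 0 := by
  have key : ∀ A : {A : Set Ω // MeasurableSet A}, ∃ B : {A : Set Ω // MeasurableSet A},
      B.1 ⊆ A.1 ∧ P.real B.1 = P.real A.1 / 2 := fun A => by
    obtain ⟨B, h1, h2, h3⟩ := hP.exists_subset_measureReal_eq A.2 (t := P.real A.1 / 2)
      (by positivity) (by linarith [measureReal_nonneg (μ := P) (s := A.1)])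
    exact ⟨⟨B, h2⟩, h1, h3⟩
  choose H hHsub hHr using key
  classical
  -- A binary tree of successive halvings; the most recent bit is the head of the list.
  let cell : List Bool → {A : Set Ω // MeasurableSet A} := fun l =>
    l.rec ⟨Set.univ, MeasurableSet.univ⟩
      fun b _ A => if b then H A else ⟨A.1 \ (H A).1, A.2.diff (H A).2⟩
  have cell_cons : ∀ b l, cell (b :: l) =
      if b then H (cell l) else ⟨(cell l).1 \ (H (cell l)).1, (cell l).2.diff (H (cell l)).2⟩ :=
    fun _ _ => rfl
  have cell_meas : ∀ l, P.real (cell l).1 = (1 / 2) ^ l.length := by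
    intro l
    induction l with
    | nil => change P.real Set.univ = _; simp
    | cons b l ih =>
      rw [cell_cons]
      cases b
      · have : P.real ((cell l).1 \ (H (cell l)).1) + P.real (H (cell l)).1 = P.real (cell l).1 := by
          rw [measureReal_sdiff (hHsub _) (H (cell l)).2]; ring
        rw [hHr, ih] at this
        simp only [Bool.false_eq_true, if_false, List.length_cons, pow_succ]
        linarith
      · simp only [if_true, List.length_cons, pow_succ]
        rw [hHr, ih]; ring
  let code : ℕ → Ω → List Bool := fun n ω =>
    n.rec [] fun _ l => decide (ω ∈ (H (cell l)).1) :: l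
  have code_succ : ∀ n ω, code (n + 1) ω = decide (ω ∈ (H (cell (code n ω))).1) :: code n ω :=
    fun _ _ => rfl
  have code_len : ∀ n ω, (code n ω).length = n := by
    intro n ω
    induction n with
    | zero => rfl
    | succ n ih => rw [code_succ, List.length_cons, ih]
  have code_mem : ∀ n ω, ω ∈ (cell (code n ω)).1 := by
    intro n ω
    induction n with
    | zero => exact Set.mem_univ _
    | succ n ih =>
      rw [code_succ, cell_cons]
      by_cases h : ω ∈ (H (cell (code n ω))).1 <;> simp [h, ih]
  have code_meas : ∀ n l, MeasurableSet {ω | code n ω = l} := by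
    intro n
    induction n with
    | zero => intro l; exact MeasurableSet.const ([] = l)
    | succ n ih =>
      intro l
      cases l with
      | nil => simp [code_succ]
      | cons b l =>
        have : {ω | code (n + 1) ω = b :: l} = {ω | code n ω = l} ∩
            {ω | decide (ω ∈ (H (cell l)).1) = b} := by
          ext ω
          simp only [code_succ, List.cons.injEq, Set.mem_ofPred_eq, Set.mem_inter_iff]
          constructor
          · rintro ⟨h1, h2⟩; rw [h2] at h1; exact ⟨h2, h1⟩
          · rintro ⟨h2, h1⟩; rw [h2]; exact ⟨h1, rfl⟩
        rw [this]
        refine (ih l).inter ?_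
        cases b
        · convert! (H (cell l)).2.compl using 1
          ext ω; simp
        · convert! (H (cell l)).2 using 1
          ext ω; simp
  let X : Ω → ℕ → Bool := fun ω n => (code (n + 1) ω).headD false
  have hX : Measurable X := by
    refine measurable_pi_lambda _ fun n => measurable_to_countable' fun b => ?_
    have : (fun ω => X ω n) ⁻¹' {b} = ⋃ l : List Bool, ⋃ _ : l.headD false = b,
        {ω | code (n + 1) ω = l} := by
      ext ω; simp [X]
    rw [this]
    exact MeasurableSet.iUnion fun l => MeasurableSet.iUnion fun _ => code_meas (n + 1) l
  refine ⟨X, hX, fun w => ?_⟩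
  have hw : ∀ n, ∃ l : List Bool, l.length = n ∧ ∀ ω, X ω = w → code n ω = l := by
    intro n
    induction n with
    | zero => exact ⟨[], rfl, fun ω _ => rfl⟩
    | succ n ih =>
      obtain ⟨l, hl, h⟩ := ih
      refine ⟨w n :: l, by simp [hl], fun ω hω => ?_⟩
      have h1 : X ω n = w n := by rw [hω]
      rw [code_succ, h ω hω]
      congr 1
      rw [← h1]
      simp only [X, code_succ, List.headD_cons, h ω hω]
  -- A fibre of `X` lies in one cell of every depth.
  have hle : ∀ n : ℕ, P.real (X ⁻¹' {w}) ≤ (1 / 2) ^ n := by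
    intro n
    obtain ⟨l, hl, h⟩ := hw n
    rw [← hl, ← cell_meas]
    refine measureReal_mono fun ω hω => ?_
    have := code_mem n ω
    rwa [h ω hω] at this
  have h0 : P.real (X ⁻¹' {w}) ≤ 0 :=
    ge_of_tendsto' (tendsto_pow_atTop_nhds_zero_of_lt_one (by norm_num) (by norm_num)) hle
  exact (measureReal_eq_zero_iff (measure_ne_top _ _)).1 (h0.antisymm measureReal_nonneg)

/-- A random variable evaluated at its own continuous distribution function is uniform. -/
theorem measureReal_cdf_le {μ : Measure ℝ} [IsProbabilityMeasure μ] (hμ : ∀ x, μ {x} = 0) {u : ℝ}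
    (hu : u ∈ Set.Icc (0 : ℝ) 1) : μ.real {y | cdf μ y ≤ u} = u := by
  have hcont : Continuous (cdf μ) := by
    refine continuous_iff_continuousAt.2 fun x => ?_
    rw [(cdf μ).mono.continuousAt_iff_leftLim_eq_rightLim, (cdf μ).rightLim_eq]
    have h := hμ x
    rw [← measure_cdf μ, StieltjesFunction.measure_singleton, ENNReal.ofReal_eq_zero] at h
    exact le_antisymm ((cdf μ).mono.leftLim_le le_rfl) (by linarith)
  have hsurj : ∀ v ∈ Set.Ioo (0 : ℝ) 1, ∃ x, cdf μ x = v := fun v hv =>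
    mem_range_of_exists_le_of_exists_ge hcont
      (((tendsto_cdf_atBot μ).eventually_le_const hv.1).exists)
      (((tendsto_cdf_atTop μ).eventually_const_le hv.2).exists)
  -- `u` itself need not be attained when `u = 0`, hence the detour through values `v > u`.
  have hup : ∀ v, u < v → v < 1 → μ.real {y | cdf μ y ≤ u} ≤ v := by
    intro v huv hv1
    obtain ⟨x, hx⟩ := hsurj v ⟨hu.1.trans_lt huv, hv1⟩
    rw [← hx, cdf_eq_real]
    refine measureReal_mono fun y hy => ?_
    by_contra hxy
    have := (cdf μ).mono (not_le.1 hxy).le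
    rw [hx] at this
    exact absurd (this.trans hy) (not_le.2 huv)
  rcases hu.2.eq_or_lt with h1 | h1
  · subst h1
    have : {y | cdf μ y ≤ 1} = Set.univ := Set.eq_univ_of_forall fun y => cdf_le_one μ y
    rw [this]; simp
  refine le_antisymm (le_of_forall_gt_imp_ge_of_dense fun v hv => ?_) ?_
  · rcases lt_or_ge v 1 with h | h
    · exact hup v hv h
    · exact measureReal_le_one.trans h
  · rcases hu.1.eq_or_lt with h0 | h0
    · rw [← h0]; exact measureReal_nonneg
    · obtain ⟨x, hx⟩ := hsurj u ⟨h0, h1⟩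
      nth_rw 1 [← hx]
      rw [cdf_eq_real]
      exact measureReal_mono fun y hy => ((cdf μ).mono hy).trans hx.le

-- An injective embedding into `ℝ` keeps the law free of atoms; the probability integral transform
-- then makes it uniform.
open unitInterval in
theorem IsAtomless.exists_uniform [IsProbabilityMeasure P] (hP : IsAtomless P) :
    ∃ U : Ω → I, Measurable U ∧ P.map U = volume := by
  obtain ⟨X, hX, hX0⟩ := hP.exists_measurable_noAtoms
  have he := measurableEmbedding_embeddingReal (ℕ → Bool)
  set Y : Ω → ℝ := fun ω => embeddingReal (ℕ → Bool) (X ω) with hYdef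
  have hY : Measurable Y := he.measurable.comp hX
  have : IsProbabilityMeasure (P.map Y) := Measure.isProbabilityMeasure_map hY.aemeasurable
  have hμ : ∀ x, (P.map Y) {x} = 0 := by
    intro x
    rw [Measure.map_apply hY (measurableSet_singleton x)]
    by_cases hx : ∃ w, embeddingReal (ℕ → Bool) w = x
    · obtain ⟨w, rfl⟩ := hx
      refine measure_mono_null (fun ω hω => ?_) (hX0 w)
      exact he.injective hω
    · convert measure_empty (μ := P)
      ext ω
      simp only [Set.mem_preimage, Set.mem_singleton_iff, Set.mem_empty_iff_false, iff_false]
      exact fun h => hx ⟨_, h⟩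
  have hc : Measurable (cdf (P.map Y)) := (cdf (P.map Y)).mono.measurable
  let U : Ω → I := fun ω => ⟨cdf (P.map Y) (Y ω), cdf_nonneg _ _, cdf_le_one _ _⟩
  have hU : Measurable U := (hc.comp hY).subtype_mk
  refine ⟨U, hU, ?_⟩
  have : IsProbabilityMeasure (P.map U) := Measure.isProbabilityMeasure_map hU.aemeasurable
  refine Measure.ext_of_Iic _ _ fun x => ?_
  rw [Measure.map_apply hU measurableSet_Iic, unitInterval.volume_Iic,
    ← measureReal_cdf_le hμ x.2, ofReal_measureReal (measure_ne_top _ _)]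
  change _ = (P.map Y) (cdf (P.map Y) ⁻¹' Set.Iic (x : ℝ))
  rw [Measure.map_apply hY (hc measurableSet_Iic)]
  rfl

theorem IsAtomless.exists_measurable_map_eq [IsProbabilityMeasure P] (hP : IsAtomless P)
    {Y : Type*} [MeasurableSpace Y] [Nonempty Y] [StandardBorelSpace Y] (μ : Measure Y)
    [IsProbabilityMeasure μ] : ∃ V : Ω → Y, Measurable V ∧ P.map V = μ := by
  obtain ⟨U, hU, hUP⟩ := hP.exists_uniform
  obtain ⟨f, hf, hfμ⟩ := Measure.exists_measurable_map_eq μ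
  exact ⟨f ∘ U, hf.comp hU, by rw [← Measure.map_map hf hU, hUP, hfμ]⟩

end Atomless

/-! ### Gluing random variables across scenarios. -/

section Scenarios

variable {Ω : Type*} [MeasurableSpace Ω] {P : Measure Ω} {s : ℕ} {S : Fin s → Set Ω}

theorem IsScenarios.isProbabilityMeasure_cond [IsFiniteMeasure P] (hS : IsScenarios P S)
    (j : Fin s) : IsProbabilityMeasure (ProbabilityTheory.cond P (S j)) :=
  cond_isProbabilityMeasure (hS.pos j)

/-- The index of the scenario that occurs. -/
noncomputable def IsScenarios.index (hS : IsScenarios P S) (ω : Ω) : Fin s :=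
  (Set.mem_iUnion.1 (hS.cover.symm ▸ Set.mem_univ ω : ω ∈ ⋃ j, S j)).choose

theorem IsScenarios.mem_index (hS : IsScenarios P S) (ω : Ω) : ω ∈ S (hS.index ω) :=
  (Set.mem_iUnion.1 (hS.cover.symm ▸ Set.mem_univ ω : ω ∈ ⋃ j, S j)).choose_spec

theorem IsScenarios.index_eq_iff (hS : IsScenarios P S) {ω : Ω} {j : Fin s} :
    hS.index ω = j ↔ ω ∈ S j := by
  constructor
  · rintro rfl; exact hS.mem_index ω
  · intro h
    by_contra hne
    exact Set.disjoint_left.1 (hS.disjoint _ _ hne) (hS.mem_index ω) h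

theorem IsScenarios.measurable_index (hS : IsScenarios P S) : Measurable hS.index :=
  measurable_to_countable' fun j => by
    convert! hS.measurable j using 1
    ext ω; exact hS.index_eq_iff

theorem IsScenarios.ae_index_eq (hS : IsScenarios P S) (j : Fin s) :
    ∀ᵐ ω ∂ProbabilityTheory.cond P (S j), hS.index ω = j := by
  filter_upwards [ae_cond_mem (μ := P) (hS.measurable j)] with ω hω
  exact hS.index_eq_iff.2 hω

/-- Atomless scenarios carry a random variable with a prescribed common law in all scenarios. -/
theorem IsScenarios.exists_measurable_map_eq [IsProbabilityMeasure P] (hP : IsAtomless P)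
    (hS : IsScenarios P S) {Y : Type*} [MeasurableSpace Y] [Nonempty Y] [StandardBorelSpace Y]
    (μ : Measure Y) [IsProbabilityMeasure μ] :
    ∃ V : Ω → Y, Measurable V ∧ ∀ j, (ProbabilityTheory.cond P (S j)).map V = μ := by
  have := hS.isProbabilityMeasure_cond
  choose V hV hVμ using fun j => (hP.cond (hS.measurable j)).exists_measurable_map_eq μ
  have hm : Measurable fun ω => V (hS.index ω) ω := by
    have h2 : Measurable (Function.uncurry V) := measurable_from_prod_countable_right hV
    exact h2.comp (hS.measurable_index.prodMk measurable_id)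
  refine ⟨_, hm, fun j => ?_⟩
  rw [← hVμ j]
  refine Measure.map_congr ?_
  filter_upwards [hS.ae_index_eq j] with ω hω
  rw [hω]

end Scenarios

/-! ### Choquet integrals of losses. -/

section Choquet

variable {Ω : Type*} [MeasurableSpace Ω] {ν : Set Ω → ℝ}

/-- The event that the loss `X` exceeds the level `x`. -/
def Loss.above (X : Loss Ω) (x : ℝ) : Set Ω := {ω | x < X ω}

theorem Loss.mem_above {X : Loss Ω} {x : ℝ} {ω : Ω} : ω ∈ X.above x ↔ x < X ω := Iff.rfl

theorem Loss.measurableSet_above (X : Loss Ω) (x : ℝ) : MeasurableSet (X.above x) :=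
  measurableSet_lt measurable_const X.2.1

theorem Loss.above_anti (X : Loss Ω) : Antitone X.above := fun _ _ hxy _ h => lt_of_le_of_lt hxy h

theorem Loss.nonneg (X : Loss Ω) (ω : Ω) : 0 ≤ X ω := (X.2.2 ω).1

theorem Loss.le_one (X : Loss Ω) (ω : Ω) : X ω ≤ 1 := (X.2.2 ω).2

theorem Loss.measurable (X : Loss Ω) : Measurable (X : Ω → ℝ) := X.2.1

theorem Loss.ext {X Y : Loss Ω} (h : ∀ ω, X ω = Y ω) : X = Y := Subtype.ext (funext h)

theorem Loss.above_eq_empty (X : Loss Ω) {x : ℝ} (hx : 1 ≤ x) : X.above x = ∅ :=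
  Set.eq_empty_of_forall_notMem fun ω h => (X.le_one ω).not_gt (hx.trans_lt h)

theorem Loss.above_eq_univ (X : Loss Ω) {x : ℝ} (hx : x < 0) : X.above x = Set.univ :=
  Set.eq_univ_of_forall fun ω => hx.trans_le (X.nonneg ω)

theorem IsCapacity.antitone (hν : IsCapacity ν) (X : Loss Ω) : Antitone fun x => ν (X.above x) :=
  fun _ _ hxy => hν.mono _ _ (X.measurableSet_above _) (X.measurableSet_above _) (X.above_anti hxy)

theorem IsCapacity.nonneg (hν : IsCapacity ν) {A : Set Ω} (hA : MeasurableSet A) : 0 ≤ ν A :=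
  hν.empty ▸ hν.mono _ _ MeasurableSet.empty hA (Set.empty_subset _)

theorem IsCapacity.le_one (hν : IsCapacity ν) {A : Set Ω} (hA : MeasurableSet A) : ν A ≤ 1 :=
  hν.univ ▸ hν.mono _ _ hA MeasurableSet.univ (Set.subset_univ _)

theorem choquet_toBdd_eq (X : Loss Ω) : choquet ν X.toBdd =
    (∫ x in Set.Ioi (0 : ℝ), ν (X.above x)) + ∫ x in Set.Iio (0 : ℝ), (ν (X.above x) - 1) := rfl

/-- The Choquet integral of a loss, over any interval `[0, M]` with `1 ≤ M`. -/
theorem IsCapacity.choquet_toBdd (hν : IsCapacity ν) (X : Loss Ω) {M : ℝ} (hM : 1 ≤ M) :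
    choquet ν X.toBdd = ∫ x in (0 : ℝ)..M, ν (X.above x) := by
  have h2 : ∫ x in Set.Iio (0 : ℝ), (ν (X.above x) - 1) = 0 :=
    setIntegral_eq_zero_of_forall_eq_zero fun x hx => by
      rw [X.above_eq_univ hx, hν.univ, sub_self]
  rw [choquet_toBdd_eq, h2, add_zero, intervalIntegral.integral_of_le (by linarith)]
  refine setIntegral_eq_of_subset_of_forall_sdiff_eq_zero measurableSet_Ioi
    Set.Ioc_subset_Ioi_self fun x hx => ?_
  have hx1 : M < x := by
    by_contra h
    exact hx.2 ⟨hx.1, not_lt.1 h⟩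
  rw [X.above_eq_empty (hM.trans hx1.le), hν.empty]

theorem IsCapacity.intervalIntegrable (hν : IsCapacity ν) (X : Loss Ω) (a b : ℝ) :
    IntervalIntegrable (fun x => ν (X.above x)) volume a b :=
  (hν.antitone X).intervalIntegrable

theorem IsCapacity.choquet_mono (hν : IsCapacity ν) {X Y : Loss Ω} (h : ∀ ω, X ω ≤ Y ω) :
    choquet ν X.toBdd ≤ choquet ν Y.toBdd := by
  rw [hν.choquet_toBdd X le_rfl, hν.choquet_toBdd Y le_rfl]
  refine intervalIntegral.integral_mono_on zero_le_one (hν.intervalIntegrable X _ _)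
    (hν.intervalIntegrable Y _ _) fun x _ => ?_
  exact hν.mono _ _ (X.measurableSet_above x) (Y.measurableSet_above x)
    fun ω hω => lt_of_lt_of_le hω (h ω)

theorem IsCapacity.choquet_mem_Icc (hν : IsCapacity ν) (X : Loss Ω) :
    choquet ν X.toBdd ∈ Set.Icc (0 : ℝ) 1 := by
  rw [hν.choquet_toBdd X le_rfl]
  constructor
  · exact intervalIntegral.integral_nonneg zero_le_one fun x _ =>
      hν.nonneg (X.measurableSet_above x)
  · calc ∫ x in (0 : ℝ)..1, ν (X.above x) ≤ ∫ x in (0 : ℝ)..1, (1 : ℝ) :=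
        intervalIntegral.integral_mono_on zero_le_one (hν.intervalIntegrable X _ _)
          intervalIntegrable_const fun x _ => hν.le_one (X.measurableSet_above x)
      _ = 1 := by simp

/-- The loss `a X + b`. -/
noncomputable def Loss.affine (a b : ℝ) (ha : 0 ≤ a) (hb : 0 ≤ b) (hab : a + b ≤ 1) (X : Loss Ω) :
    Loss Ω :=
  ⟨fun ω => a * X ω + b, (X.2.1.const_mul a).add_const b, fun ω =>
    ⟨add_nonneg (mul_nonneg ha (X.nonneg ω)) hb, by
      nlinarith [mul_le_mul_of_nonneg_left (X.le_one ω) ha]⟩⟩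

/-- The indicator function of an event. -/
noncomputable def Loss.ind (A : Set Ω) (hA : MeasurableSet A) : Loss Ω :=
  ⟨A.indicator 1, measurable_const.indicator hA, fun ω =>
    ⟨Set.indicator_nonneg (fun _ _ => zero_le_one) ω,
      Set.indicator_le' (fun _ _ => le_rfl) (fun _ _ => zero_le_one) ω⟩⟩

theorem IsCapacity.choquet_affine (hν : IsCapacity ν) {a b : ℝ} (ha : 0 < a) (hb : 0 ≤ b)
    (hab : a + b ≤ 1) (X : Loss Ω) :
    choquet ν (X.affine a b ha.le hb hab).toBdd = a * choquet ν X.toBdd + b := by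
  -- The substitution `x ↦ a * x + b` sends this upper limit to 1. Levels below `b` are exceeded
  -- everywhere and contribute `b`.
  have hM : 1 ≤ (1 - b) / a := by rw [le_div_iff₀ ha]; linarith
  set Y := X.affine a b ha.le hb hab
  rw [hν.choquet_toBdd Y le_rfl, hν.choquet_toBdd X hM]
  have hY : ∀ x, X.above x = Y.above (a * x + b) := by
    intro x; ext ω
    change x < X ω ↔ a * x + b < a * X ω + b
    rw [add_lt_add_iff_right, mul_lt_mul_iff_right₀ ha]
  simp_rw [hY]
  rw [intervalIntegral.integral_comp_mul_add (fun y => ν (Y.above y)) ha.ne', smul_eq_mul,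
    ← mul_assoc, mul_inv_cancel₀ ha.ne', one_mul]
  have e1 : a * 0 + b = b := by ring
  have e2 : a * ((1 - b) / a) + b = 1 := by field_simp; ring
  rw [e1, e2, ← intervalIntegral.integral_add_adjacent_intervals
    (hν.intervalIntegrable Y 0 b) (hν.intervalIntegrable Y b 1), add_comm]
  congr 1
  have : ∫ x in (0 : ℝ)..b, ν (Y.above x) = ∫ x in (0 : ℝ)..b, (1 : ℝ) := by
    refine intervalIntegral.integral_congr_Ioo_of_le hb fun x hx => ?_
    have : Y.above x = Set.univ := Set.eq_univ_of_forall fun ω => by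
      change x < a * X ω + b
      linarith [hx.2, mul_nonneg ha.le (X.nonneg ω)]
    simp only [this, hν.univ]
  rw [this]; simp

/-- All losses used to test `ν` take only the values 0, 1/2 and 1, so their risk is an average of
two values of `ν`. -/
theorem IsCapacity.choquet_two_step (hν : IsCapacity ν) (X : Loss Ω) {C D : Set Ω}
    (hC : ∀ x ∈ Set.Ioo (0 : ℝ) (1 / 2), X.above x = C)
    (hD : ∀ x ∈ Set.Ioo (1 / 2 : ℝ) 1, X.above x = D) :
    choquet ν X.toBdd = (ν C + ν D) / 2 := by
  rw [hν.choquet_toBdd X le_rfl, ← intervalIntegral.integral_add_adjacent_intervals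
    (hν.intervalIntegrable X 0 (1 / 2)) (hν.intervalIntegrable X (1 / 2) 1)]
  have h1 : ∫ x in (0 : ℝ)..1 / 2, ν (X.above x) = ∫ x in (0 : ℝ)..1 / 2, ν C :=
    intervalIntegral.integral_congr_Ioo_of_le (by norm_num) fun x hx => by simp only [hC x hx]
  have h2 : ∫ x in (1 / 2 : ℝ)..1, ν (X.above x) = ∫ x in (1 / 2 : ℝ)..1, ν D :=
    intervalIntegral.integral_congr_Ioo_of_le (by norm_num) fun x hx => by simp only [hD x hx]
  rw [h1, h2]
  simp only [intervalIntegral.integral_const, smul_eq_mul]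
  ring

theorem Loss.lt_ind_iff {A : Set Ω} (hA : MeasurableSet A) {x : ℝ} (hx : x ∈ Set.Ico (0 : ℝ) 1)
    (ω : Ω) : x < Loss.ind A hA ω ↔ ω ∈ A := by
  change x < A.indicator 1 ω ↔ _
  by_cases h : ω ∈ A
  · simp [h, hx.2]
  · simp [h, hx.1]

theorem IsCapacity.choquet_ind (hν : IsCapacity ν) {A : Set Ω} (hA : MeasurableSet A) :
    choquet ν (Loss.ind A hA).toBdd = ν A := by
  rw [hν.choquet_two_step (C := A) (D := A)]
  · ring
  · intro x hx; ext ω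
    exact Loss.lt_ind_iff hA ⟨hx.1.le, by linarith [hx.2]⟩ ω
  · intro x hx; ext ω
    exact Loss.lt_ind_iff hA ⟨by linarith [hx.1], hx.2⟩ ω

end Choquet

/-! ### Recovering the order of risks from ratings. -/

section Rating

variable {Ω : Type*} [MeasurableSpace Ω] {n : ℕ} {I : RatingCriterion Ω n} {ρ : BddRV Ω → ℝ}

theorem IsChoquetRepresentation.exists_capacity (hρ : IsChoquetRepresentation I ρ) :
    ∃ ν : Set Ω → ℝ, IsCapacity ν ∧ ∀ X, ρ X = choquet ν X := hρ.1

theorem IsChoquetRepresentation.rho_mem_Icc (hρ : IsChoquetRepresentation I ρ) (X : Loss Ω) :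
    ρ X.toBdd ∈ Set.Icc (0 : ℝ) 1 := by
  obtain ⟨ν, hν, h⟩ := hρ.exists_capacity
  rw [h]; exact hν.choquet_mem_Icc X

theorem IsChoquetRepresentation.rate_le_of_rho_le (hρ : IsChoquetRepresentation I ρ) {X Y : Loss Ω}
    (h : ρ X.toBdd ≤ ρ Y.toBdd) : I.rate X ≤ I.rate Y := by
  obtain ⟨f, -, hf, -, -, -, hI⟩ := hρ.2
  rw [hI, hI]
  exact hf (hρ.rho_mem_Icc X) (hρ.rho_mem_Icc Y) h

/-- A rating criterion separates the losses whose risk lies on different sides of some level. -/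
theorem IsChoquetRepresentation.exists_threshold (hρ : IsChoquetRepresentation I ρ) :
    ∃ c ∈ Set.Ioo (0 : ℝ) 1, ∀ X Y : Loss Ω, ρ X.toBdd < c → c < ρ Y.toBdd →
      I.rate X < I.rate Y := by
  obtain ⟨f, -, hf, -, -, hne, hI⟩ := hρ.2
  obtain ⟨x, hx, y, hy, hxy⟩ : ∃ x ∈ Set.Ioo (0 : ℝ) 1, ∃ y ∈ Set.Ioo (0 : ℝ) 1, f x < f y := by
    obtain ⟨x, hx, y, hy, hxy⟩ := hne
    rcases lt_or_gt_of_ne hxy with h | h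
    · exact ⟨x, hx, y, hy, h⟩
    · exact ⟨y, hy, x, hx, h⟩
  -- The level is the point where `f` first exceeds `f x`; the value of `f` at that point is not
  -- controlled, so both inequalities must be strict.
  let T : Set ℝ := {t | t ∈ Set.Icc (0 : ℝ) 1 ∧ f t ≤ f x}
  have hxT : x ∈ T := ⟨Set.Ioo_subset_Icc_self hx, le_rfl⟩
  have hTy : ∀ t ∈ T, t ≤ y := by
    intro t ht
    by_contra h
    exact absurd (hf (Set.Ioo_subset_Icc_self hy) ht.1 (not_le.1 h).le) (by
      have := ht.2; omega)
  have hbd : BddAbove T := ⟨y, hTy⟩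
  refine ⟨sSup T, ⟨hx.1.trans_le (le_csSup hbd hxT), (csSup_le ⟨x, hxT⟩ hTy).trans_lt hy.2⟩,
    fun X Y hX hY => ?_⟩
  rw [hI, hI]
  obtain ⟨t, ht, hlt⟩ := exists_lt_of_lt_csSup ⟨x, hxT⟩ hX
  have h1 : f (ρ X.toBdd) ≤ f x := (hf (hρ.rho_mem_Icc X) ht.1 hlt.le).trans ht.2
  refine h1.trans_lt (not_le.1 fun h => ?_)
  exact absurd (le_csSup hbd ⟨hρ.rho_mem_Icc Y, h⟩) (not_le.2 hY)

theorem IsChoquetRepresentation.rho_affine (hρ : IsChoquetRepresentation I ρ) {a b : ℝ} (ha : 0 < a)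
    (hb : 0 ≤ b) (hab : a + b ≤ 1) (X : Loss Ω) :
    ρ (X.affine a b ha.le hb hab).toBdd = a * ρ X.toBdd + b := by
  obtain ⟨ν, hν, h⟩ := hρ.exists_capacity
  rw [h, h, hν.choquet_affine ha]

/-- The ratings of the rescaled losses determine the order of the risks. -/
theorem IsChoquetRepresentation.rho_le_of_rate_affine_le (hρ : IsChoquetRepresentation I ρ)
    {X Y : Loss Ω} (h : ∀ (a b : ℝ) (ha : 0 < a) (hb : 0 ≤ b) (hab : a + b ≤ 1),
      I.rate (X.affine a b ha.le hb hab) ≤ I.rate (Y.affine a b ha.le hb hab)) :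
    ρ X.toBdd ≤ ρ Y.toBdd := by
  by_contra! hlt
  obtain ⟨c, ⟨hc0, hc1⟩, hc⟩ := hρ.exists_threshold
  obtain ⟨hX0, hX1⟩ := hρ.rho_mem_Icc X
  obtain ⟨hY0, hY1⟩ := hρ.rho_mem_Icc Y
  -- The map `r ↦ a * r + (c - a * m)` sends the midpoint of the two risks to `c`; the choice of `a`
  -- keeps the transformed losses in `[0,1]`.
  set m := (ρ X.toBdd + ρ Y.toBdd) / 2 with hm
  set a := min c (1 - c) with ha
  have ha0 : 0 < a := lt_min hc0 (by linarith)
  have hac : a ≤ c := min_le_left _ _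
  have hac' : a ≤ 1 - c := min_le_right _ _
  have hm0 : 0 ≤ m := by linarith
  have hm1 : m ≤ 1 := by linarith
  have hb : 0 ≤ c - a * m := by nlinarith
  have hab : a + (c - a * m) ≤ 1 := by nlinarith
  refine absurd (h a (c - a * m) ha0 hb hab) (not_le.2 (hc _ _ ?_ ?_))
  · rw [hρ.rho_affine ha0]; nlinarith
  · rw [hρ.rho_affine ha0]; nlinarith

end Rating

/-! ### The canonical distortion function and its continuity. -/

section Distortion

variable {Ω : Type*} [MeasurableSpace Ω] {P : Measure Ω} {s : ℕ} {S : Fin s → Set Ω} {n : ℕ}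
  {I : RatingCriterion Ω n} {ρ : BddRV Ω → ℝ} {ν : Set Ω → ℝ}

theorem choquet_congr {ν' : Set Ω → ℝ} (h : ∀ A, MeasurableSet A → ν A = ν' A) (X : BddRV Ω) :
    choquet ν X = choquet ν' X := by
  have : ∀ x : ℝ, ν {ω | x < X ω} = ν' {ω | x < X ω} := fun x =>
    h _ (measurableSet_lt measurable_const X.2.1)
  unfold choquet
  congr 1
  · exact integral_congr_ae (Filter.Eventually.of_forall fun x => this x)
  · exact integral_congr_ae (Filter.Eventually.of_forall fun x => by simp only [this x])

theorem identDistrib_indicator {Q : Measure Ω} [IsProbabilityMeasure Q] {A B : Set Ω}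
    (hA : MeasurableSet A) (hB : MeasurableSet B) (h : Q.real A = Q.real B) :
    IdentDistrib (A.indicator (1 : Ω → ℝ)) (B.indicator (1 : Ω → ℝ)) Q Q := by
  have hmA : Measurable (A.indicator (1 : Ω → ℝ)) := measurable_const.indicator hA
  have hmB : Measurable (B.indicator (1 : Ω → ℝ)) := measurable_const.indicator hB
  refine ⟨hmA.aemeasurable, hmB.aemeasurable, Measure.ext fun T hT => ?_⟩
  have h' : Q A = Q B := (ENNReal.toReal_eq_toReal_iff' (measure_ne_top _ _) (measure_ne_top _ _)).1 h
  rw [Measure.map_apply hmA hT, Measure.map_apply hmB hT]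
  have hpre : ∀ C : Set Ω, C.indicator (1 : Ω → ℝ) ⁻¹' T =
      {ω | (ω ∈ C ∧ (1 : ℝ) ∈ T) ∨ (ω ∉ C ∧ (0 : ℝ) ∈ T)} := by
    intro C; ext ω
    by_cases hω : ω ∈ C <;> simp [hω]
  rw [hpre, hpre]
  by_cases h1 : (1 : ℝ) ∈ T <;> by_cases h0 : (0 : ℝ) ∈ T
  · congr 1; ext ω; simp [h1, h0, em]
  · simpa [h1, h0] using h'
  · have : Q Aᶜ = Q Bᶜ := by rw [prob_compl_eq_one_sub hA, prob_compl_eq_one_sub hB, h']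
    simpa [h1, h0] using! this
  · simp [h1, h0]

theorem IsChoquetRepresentation.rho_eq_of_identDistrib (hρ : IsChoquetRepresentation I ρ)
    (hLI : SLawInvariant P S I) {X Y : Loss Ω}
    (h : ∀ j, IdentDistrib (X : Ω → ℝ) (Y : Ω → ℝ) (cond P (S j)) (cond P (S j))) :
    ρ X.toBdd = ρ Y.toBdd := by
  have key : ∀ (a b : ℝ) (ha : 0 < a) (hb : 0 ≤ b) (hab : a + b ≤ 1),
      I.rate (X.affine a b ha.le hb hab) = I.rate (Y.affine a b ha.le hb hab) := by
    intro a b ha hb hab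
    refine hLI _ _ fun j => ?_
    exact (h j).comp (u := fun x => a * x + b) (by fun_prop)
  exact le_antisymm (hρ.rho_le_of_rate_affine_le fun a b ha hb hab => (key a b ha hb hab).le)
    (hρ.rho_le_of_rate_affine_le fun a b ha hb hab => (key a b ha hb hab).ge)

/-- Indicators of events with equal scenario probabilities have equal laws in each scenario, and the
Choquet integral of an indicator is the capacity of its event. -/
theorem IsChoquetRepresentation.capacity_eq [IsProbabilityMeasure P] (hS : IsScenarios P S)
    (hρ : IsChoquetRepresentation I ρ) (hLI : SLawInvariant P S I) (hν : IsCapacity ν)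
    (hρν : ∀ X, ρ X = choquet ν X) {A B : Set Ω} (hA : MeasurableSet A) (hB : MeasurableSet B)
    (h : scenarioProb P S A = scenarioProb P S B) : ν A = ν B := by
  have := hS.isProbabilityMeasure_cond
  have h1 := hρ.rho_eq_of_identDistrib (X := Loss.ind A hA) (Y := Loss.ind B hB) hLI fun j =>
    identDistrib_indicator hA hB (congrFun h j)
  rwa [hρν, hρν, hν.choquet_ind, hν.choquet_ind] at h1

theorem IsScenarios.ae_of_ae_cond [IsFiniteMeasure P] (hS : IsScenarios P S) {p : Ω → Prop}
    (h : ∀ j, ∀ᵐ ω ∂cond P (S j), p ω) : ∀ᵐ ω ∂P, p ω := by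
  have h2 : ∀ᵐ ω ∂P.restrict (⋃ j, S j), p ω := by
    rw [ae_restrict_iUnion_iff]
    intro j
    have := h j
    rwa [ProbabilityTheory.cond, Measure.ae_ennreal_smul_measure_iff
      (ENNReal.inv_ne_zero.2 (measure_ne_top _ _))] at this
  rwa [hS.cover, Measure.restrict_univ] at h2

theorem scenarioProb_mem_Icc [IsFiniteMeasure P] (hS : IsScenarios P S) (A : Set Ω) :
    scenarioProb P S A ∈ Set.Icc (0 : Fin s → ℝ) 1 := by
  have := hS.isProbabilityMeasure_cond
  exact ⟨fun j => measureReal_nonneg, fun j => measureReal_le_one⟩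

theorem scenarioProb_empty : scenarioProb P S ∅ = 0 := by
  ext j; simp [scenarioProb]

theorem scenarioProb_univ [IsFiniteMeasure P] (hS : IsScenarios P S) :
    scenarioProb P S Set.univ = 1 := by
  have := hS.isProbabilityMeasure_cond
  ext j; simp [scenarioProb]

theorem scenarioProb_mono [IsFiniteMeasure P] (hS : IsScenarios P S) {A B : Set Ω} (h : A ⊆ B) :
    scenarioProb P S A ≤ scenarioProb P S B := by
  have := hS.isProbabilityMeasure_cond
  exact fun j => measureReal_mono h

theorem IsSDistortionFunction.isCapacity [IsFiniteMeasure P] (hS : IsScenarios P S)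
    {g : (Fin s → ℝ) → ℝ} (hg : IsSDistortionFunction P S ρ g) :
    IsCapacity fun A => g (scenarioProb P S A) where
  empty := by rw [scenarioProb_empty, hg.zero]
  univ := by rw [scenarioProb_univ hS, hg.one]
  mono _ _ _ _ h := hg.mono (scenarioProb_mem_Icc hS _) (scenarioProb_mem_Icc hS _)
    (scenarioProb_mono hS h)

/-- The random variable `U` is uniformly distributed on `[0,1]` in each scenario. -/
structure IsUniform (P : Measure Ω) (S : Fin s → Set Ω) (U : Ω → unitInterval) : Prop where
  measurable : Measurable U
  map_eq : ∀ j, (cond P (S j)).map U = volume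

/-- The event that `U` is smaller than `x j` in scenario `j`. -/
def IsScenarios.lower (hS : IsScenarios P S) (U : Ω → unitInterval) (x : Fin s → ℝ) : Set Ω :=
  {ω | (U ω : ℝ) < x (hS.index ω)}

variable {U : Ω → unitInterval}

theorem IsScenarios.measurableSet_lower (hS : IsScenarios P S) (hU : IsUniform P S U)
    (x : Fin s → ℝ) : MeasurableSet (hS.lower U x) :=
  measurableSet_lt hU.measurable.subtype_val ((measurable_of_countable x).comp hS.measurable_index)

theorem IsScenarios.lower_mono (hS : IsScenarios P S) (U : Ω → unitInterval) :
    Monotone (hS.lower U) := fun _ _ hxy ω h => lt_of_lt_of_le h (hxy (hS.index ω))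

theorem IsUniform.measureReal_lt (hU : IsUniform P S U) (j : Fin s) {u : ℝ}
    (hu : u ∈ Set.Icc (0 : ℝ) 1) : (cond P (S j)).real {ω | (U ω : ℝ) < u} = u := by
  have h : (cond P (S j)).real {ω | (U ω : ℝ) < u} =
      ((cond P (S j)).map U).real (Set.Iio ⟨u, hu⟩) := by
    rw [map_measureReal_apply hU.measurable measurableSet_Iio]; rfl
  rw [h, hU.map_eq, Measure.real, unitInterval.volume_Iio, ENNReal.toReal_ofReal hu.1]

theorem IsUniform.ae_ne (hU : IsUniform P S U) (j : Fin s) (u : ℝ) :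
    ∀ᵐ ω ∂cond P (S j), (U ω : ℝ) ≠ u := by
  by_cases hu : u ∈ Set.Icc (0 : ℝ) 1
  · have h : ((cond P (S j)).map U) {⟨u, hu⟩} = 0 := by
      rw [hU.map_eq]; simp
    rw [Measure.map_apply hU.measurable (measurableSet_singleton _)] at h
    rw [ae_iff]
    refine measure_mono_null (fun ω hω => ?_) h
    exact Subtype.ext (not_not.1 hω)
  · exact Filter.Eventually.of_forall fun ω h => hu (h ▸ (U ω).2)

theorem IsScenarios.scenarioProb_lower (hS : IsScenarios P S) (hU : IsUniform P S U)
    {x : Fin s → ℝ} (hx : x ∈ Set.Icc (0 : Fin s → ℝ) 1) :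
    scenarioProb P S (hS.lower U x) = x := by
  ext j
  rw [← hU.measureReal_lt j ⟨hx.1 j, hx.2 j⟩]
  refine measureReal_congr ?_
  filter_upwards [hS.ae_index_eq j] with ω hω
  refine propext ?_
  change (U ω : ℝ) < x (hS.index ω) ↔ (U ω : ℝ) < x j
  rw [hω]

/-- Every event has the same capacity as the lower set with its scenario probabilities; lower sets
increase with their vector, which gives monotonicity. -/
theorem IsScenarios.isSDistortionFunction_lower [IsProbabilityMeasure P] (hS : IsScenarios P S)
    (hU : IsUniform P S U) (hρ : IsChoquetRepresentation I ρ) (hLI : SLawInvariant P S I)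
    (hν : IsCapacity ν) (hρν : ∀ X, ρ X = choquet ν X) :
    IsSDistortionFunction P S ρ fun x => ν (hS.lower U x) := by
  have key : ∀ A, MeasurableSet A → ν A = ν (hS.lower U (scenarioProb P S A)) := fun A hA =>
    hρ.capacity_eq hS hLI hν hρν hA (hS.measurableSet_lower hU _)
      (hS.scenarioProb_lower hU (scenarioProb_mem_Icc hS A)).symm
  refine ⟨fun x _ y _ hxy => hν.mono _ _ (hS.measurableSet_lower hU _)
    (hS.measurableSet_lower hU _) (hS.lower_mono U hxy), ?_, ?_, fun X => ?_⟩
  · have := key ∅ MeasurableSet.empty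
    rw [scenarioProb_empty, hν.empty] at this
    exact this.symm
  · have := key Set.univ MeasurableSet.univ
    rw [scenarioProb_univ hS, hν.univ] at this
    exact this.symm
  · rw [hρν]; exact choquet_congr key X

/-- If `x l → y`, the indicators of the lower sets converge wherever `U` differs from the relevant
coordinate of `y`, that is almost surely, as `U` has no atoms. -/
theorem IsScenarios.continuous_lower [IsProbabilityMeasure P] (hS : IsScenarios P S)
    (hU : IsUniform P S U) (hν : IsCapacity ν) (hρν : ∀ X, ρ X = choquet ν X)
    (hLC : LebesgueContinuous P ρ) : Continuous fun x => ν (hS.lower U x) := by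
  refine continuous_iff_seqContinuous.2 fun x y hxy => ?_
  let X : (Fin s → ℝ) → Loss Ω := fun z => Loss.ind _ (hS.measurableSet_lower hU z)
  have hX : ∀ z, ν (hS.lower U z) = ρ (X z).toBdd := fun z => by rw [hρν, hν.choquet_ind]
  have := hLC (fun l => (X (x l)).toBdd) (X y).toBdd
    ⟨1, fun l ω => abs_le.2 ⟨by linarith [(X (x l)).nonneg ω, show (X (x l)).toBdd.1 ω = X (x l) ω from rfl],
      (X (x l)).le_one ω⟩⟩ ?_
  · simpa only [Function.comp_def, hX] using! this
  refine hS.ae_of_ae_cond fun j => ?_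
  filter_upwards [hS.ae_index_eq j, hU.ae_ne j (y j)] with ω hω hne
  have hlim : Filter.Tendsto (fun l => x l j) Filter.atTop (nhds (y j)) :=
    (continuous_apply j).continuousAt.tendsto.comp hxy
  refine tendsto_const_nhds.congr' ?_
  have hind : ∀ z : Fin s → ℝ, (X z).toBdd.1 ω = if (U ω : ℝ) < z j then 1 else 0 := by
    intro z
    change (hS.lower U z).indicator 1 ω = _
    simp only [Set.indicator_apply, IsScenarios.lower, Set.mem_ofPred_eq, hω, Pi.one_apply]
  rcases lt_or_gt_of_ne hne with h | h
  · filter_upwards [hlim.eventually_const_lt h] with l hl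
    rw [hind, hind, if_pos h, if_pos hl]
  · filter_upwards [hlim.eventually_lt_const h] with l hl
    rw [hind, hind, if_neg h.not_gt, if_neg hl.not_gt]

/-- Testing on indicators shows that a distortion function is unique on the cube. Any witness of
(iv) thus agrees there with a continuous function. -/
theorem IsSDistortionFunction.eq_lower [IsProbabilityMeasure P] (hS : IsScenarios P S)
    (hU : IsUniform P S U) (hν : IsCapacity ν) (hρν : ∀ X, ρ X = choquet ν X)
    {g : (Fin s → ℝ) → ℝ} (hg : IsSDistortionFunction P S ρ g) {x : Fin s → ℝ}
    (hx : x ∈ Set.Icc (0 : Fin s → ℝ) 1) : g x = ν (hS.lower U x) := by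
  have hm := hS.measurableSet_lower hU x
  have h := hg.repr (Loss.ind _ hm).toBdd
  rw [hρν, hν.choquet_ind, (hg.isCapacity hS).choquet_ind, hS.scenarioProb_lower hU hx] at h
  exact h.symm

end Distortion

/-! ### Concavity and comparison of increments from small scales. -/

section RealFunctions

/-- A continuous function that is midpoint concave at small scales is concave. -/
theorem concaveOn_of_local_midpoint {k : ℝ → ℝ} (hk : Continuous k)
    (h : ∀ t d, 0 ≤ d → 0 ≤ t - 2 * d → t + 2 * d ≤ 1 → k (t + d) + k (t - d) ≤ 2 * k t) :
    ConcaveOn ℝ (Set.Icc 0 1) k := by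
  refine LinearOrder.concaveOn_of_lt (convex_Icc 0 1) fun a ha b hb hab p q hp hq hpq => ?_
  set m := (k b - k a) / (b - a) with hm
  -- Subtracting the chord keeps the midpoint inequality and reduces concavity to nonnegativity
  -- between two zeros.
  set φ : ℝ → ℝ := fun t => k t - (k a + m * (t - a)) with hφ
  have hba : b - a ≠ 0 := by linarith
  have hφa : φ a = 0 := by simp [hφ]
  have hφb : φ b = 0 := by simp only [hφ, hm]; field_simp; ring
  have hφc : Continuous φ := by fun_prop
  have hφmid : ∀ t d, 0 ≤ d → 0 ≤ t - 2 * d → t + 2 * d ≤ 1 →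
      φ (t + d) + φ (t - d) ≤ 2 * φ t := by
    intro t d h0 h1 h2
    have := h t d h0 h1 h2
    simp only [hφ]; linarith
  suffices hpos : ∀ c ∈ Set.Icc a b, 0 ≤ φ c by
    have hc : p • a + q • b ∈ Set.Icc a b := by
      simp only [smul_eq_mul]
      have hp' : p = 1 - q := by linarith
      subst hp'
      constructor <;> nlinarith
    have := hpos _ hc
    simp only [hφ, smul_eq_mul] at this ⊢
    have e : m * (p * a + q * b - a) = q * (k b - k a) := by
      have hp' : p = 1 - q := by linarith
      subst hp'
      rw [hm]; field_simp; ring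
    rw [e] at this
    have hp' : p = 1 - q := by linarith
    subst hp'
    linarith
  by_contra! hneg
  obtain ⟨c, hc, hc0⟩ := hneg
  obtain ⟨z, hz, hzmin⟩ := isCompact_Icc.exists_isMinOn ⟨c, hc⟩ (hφc.continuousOn (s := Set.Icc a b))
  have hzmin' : ∀ t ∈ Set.Icc a b, φ z ≤ φ t := fun t ht => hzmin ht
  have hz0 : φ z < 0 := (hzmin' c hc).trans_lt hc0
  have hcomp : IsCompact (Set.Icc a b ∩ φ ⁻¹' {φ z}) :=
    isCompact_Icc.inter_right (isClosed_singleton.preimage hφc)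
  -- At the leftmost minimizer `t`, the midpoint inequality forces `t - d` to be a minimizer too, a
  -- contradiction.
  obtain ⟨t, ⟨ht, htz⟩, hleast⟩ := hcomp.exists_isLeast ⟨z, hz, rfl⟩
  have htz' : φ t = φ z := htz
  have hta : a < t := lt_of_le_of_ne ht.1 fun e => by rw [← e, hφa] at htz'; linarith
  have htb : t < b := lt_of_le_of_ne ht.2 fun e => by rw [e, hφb] at htz'; linarith
  set d := min (t - a) (b - t) / 2 with hd
  have hd0 : 0 < d := by
    have : 0 < min (t - a) (b - t) := lt_min (by linarith) (by linarith)
    linarith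
  have hd1 : 2 * d ≤ t - a := by linarith [min_le_left (t - a) (b - t)]
  have hd2 : 2 * d ≤ b - t := by linarith [min_le_right (t - a) (b - t)]
  have h1 := hφmid t d hd0.le (by linarith [ha.1]) (by linarith [hb.2])
  have h2 := hzmin' (t + d) ⟨by linarith, by linarith⟩
  have h3 := hzmin' (t - d) ⟨by linarith, by linarith⟩
  have h4 : t ≤ t - d := hleast ⟨⟨by linarith, by linarith⟩, by
    change φ (t - d) = φ z; linarith⟩
  linarith

/-- Comparison of increments follows from shifted comparison at small scales. -/
theorem sub_le_sub_of_local {k l : ℝ → ℝ} (hk : Continuous k) (hl : Continuous l)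
    (h : ∀ t d, 0 ≤ d → 0 ≤ t - 2 * d → t + 2 * d ≤ 1 → k (t + d) - k t ≤ l t - l (t - d))
    {a b : ℝ} (ha : 0 ≤ a) (hab : a ≤ b) (hb : b ≤ 1) : k b - k a ≤ l b - l a := by
  -- Telescoping in steps of length `d` compares `k` on `[a, b]` with `l` on `[a - d, b - d]`, and
  -- `d → 0`. The local hypothesis needs room `2 * d` on both sides, hence first an interval inside
  -- `(0,1)`.
  have hopen : ∀ a b : ℝ, 0 < a → a ≤ b → b < 1 → k b - k a ≤ l b - l a := by
    intro a b ha hab hb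
    have hlim : Filter.Tendsto (fun N : ℕ => (b - a) / ((N : ℝ) + 1)) Filter.atTop (nhds 0) := by
      simpa [Function.comp_def] using!
        (tendsto_const_div_atTop_nhds_zero_nat (b - a)).comp (Filter.tendsto_add_atTop_nat 1)
    have hlim2 : Filter.Tendsto (fun N : ℕ => l (b - (b - a) / ((N : ℝ) + 1)) -
        l (a - (b - a) / ((N : ℝ) + 1))) Filter.atTop (nhds (l (b - 0) - l (a - 0))) :=
      ((hl.tendsto _).comp (hlim.const_sub b)).sub ((hl.tendsto _).comp (hlim.const_sub a))
    rw [sub_zero, sub_zero] at hlim2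
    refine ge_of_tendsto hlim2 ?_
    have hsmall : 0 < min a (1 - b) / 2 := by
      have : 0 < min a (1 - b) := lt_min ha (by linarith)
      linarith
    filter_upwards [hlim.eventually_lt_const hsmall] with N hN
    set d := (b - a) / ((N : ℝ) + 1) with hd
    have hN1 : (0 : ℝ) < N + 1 := by positivity
    have hd0 : 0 ≤ d := div_nonneg (by linarith) hN1.le
    have hNd : ((N + 1 : ℕ) : ℝ) * d = b - a := by
      rw [hd]; push_cast; field_simp
    have h1 : 2 * d ≤ a := by linarith [min_le_left a (1 - b)]
    have h2 : 2 * d ≤ 1 - b := by linarith [min_le_right a (1 - b)]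
    have hsum : ∑ i ∈ Finset.range (N + 1), (k (a + (i + 1 : ℕ) * d) - k (a + (i : ℕ) * d)) ≤
        ∑ i ∈ Finset.range (N + 1), (l (a - d + (i + 1 : ℕ) * d) - l (a - d + (i : ℕ) * d)) := by
      refine Finset.sum_le_sum fun i hi => ?_
      have hiN : ((i : ℕ) : ℝ) * d ≤ b - a := by
        rw [← hNd]
        exact mul_le_mul_of_nonneg_right (by exact_mod_cast (Finset.mem_range.1 hi).le) hd0
      have hi0 : 0 ≤ (i : ℝ) * d := by positivity
      have := h (a + i * d) d hd0 (by linarith) (by linarith)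
      have e1 : a + ((i + 1 : ℕ) : ℝ) * d = a + i * d + d := by push_cast; ring
      have e2 : a - d + ((i + 1 : ℕ) : ℝ) * d = a + i * d := by push_cast; ring
      have e3 : a - d + (i : ℝ) * d = a + i * d - d := by ring
      rwa [e1, e2, e3]
    rw [Finset.sum_range_sub (fun i : ℕ => k (a + i * d)),
      Finset.sum_range_sub (fun i : ℕ => l (a - d + i * d)), hNd] at hsum
    have e1 : a + (b - a) = b := by ring
    have e2 : a - d + (b - a) = b - d := by ring
    simpa only [e1, e2, Nat.cast_zero, zero_mul, add_zero] using hsum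
  have hcont : ∀ f : ℝ → ℝ, Continuous f → Filter.Tendsto
      (fun ε => f ((1 - ε) * b + ε / 2) - f ((1 - ε) * a + ε / 2)) (nhdsWithin 0 (Set.Ioi 0))
      (nhds (f b - f a)) := by
    intro f hf
    have : Continuous fun ε : ℝ => f ((1 - ε) * b + ε / 2) - f ((1 - ε) * a + ε / 2) := by fun_prop
    have h2 := this.tendsto 0
    simp only [sub_zero, one_mul, zero_div, add_zero] at h2
    exact h2.mono_left nhdsWithin_le_nhds
  -- The endpoints are pulled towards 1/2, and continuity removes the pull.
  refine le_of_tendsto_of_tendsto (hcont k hk) (hcont l hl) ?_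
  filter_upwards [Ioo_mem_nhdsGT (zero_lt_one' ℝ)] with ε hε
  have h1 : 0 < 1 - ε := by linarith [hε.2]
  exact hopen _ _ (by nlinarith [hε.1]) (by nlinarith) (by nlinarith [hε.1])

/-- The points `q` and `p + d` are convex combinations of `p` and `q + d` with interchanged weights;
the two concavity inequalities are added. -/
theorem _root_.ConcaveOn.add_sub_le_add_sub {D : Set ℝ} {k : ℝ → ℝ} (hk : ConcaveOn ℝ D k)
    {p q d : ℝ} (hp : p ∈ D) (hpq : p ≤ q) (hd : 0 ≤ d) (hq : q + d ∈ D) :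
    k (q + d) - k q ≤ k (p + d) - k p := by
  rcases hd.eq_or_lt with rfl | hd
  · simp
  set r := q + d - p with hr
  have hr0 : 0 < r := by linarith
  have e1 : (d / r) + ((q - p) / r) = 1 := by
    rw [← add_div, div_eq_one_iff_eq hr0.ne', hr]; ring
  have h1 := hk.2 hp hq (div_nonneg hd.le hr0.le) (div_nonneg (by linarith) hr0.le) e1
  have h2 := hk.2 hp hq (div_nonneg (by linarith) hr0.le) (div_nonneg hd.le hr0.le)
    ((add_comm _ _).trans e1)
  have f1 : (d / r) • p + ((q - p) / r) • (q + d) = q := by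
    simp only [smul_eq_mul]; field_simp; rw [hr]; ring
  have f2 : ((q - p) / r) • p + (d / r) • (q + d) = p + d := by
    simp only [smul_eq_mul]; field_simp; rw [hr]; ring
  rw [f1] at h1
  rw [f2] at h2
  simp only [smul_eq_mul] at h1 h2
  have e2 : (q - p) / r = 1 - d / r := by linarith
  rw [e2] at h1 h2
  linarith

end RealFunctions

/-! ### Submodularity and componentwise concavity on the cube. -/

section Box

variable {s : ℕ} {g : (Fin s → ℝ) → ℝ}

theorem update_mem_box {x : Fin s → ℝ} (hx : x ∈ Set.Icc (0 : Fin s → ℝ) 1) (j : Fin s) {t : ℝ}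
    (ht : t ∈ Set.Icc (0 : ℝ) 1) : Function.update x j t ∈ Set.Icc (0 : Fin s → ℝ) 1 := by
  constructor <;> intro i <;> by_cases hi : i = j
  · subst hi; simpa using ht.1
  · simpa [hi] using hx.1 i
  · subst hi; simpa using ht.2
  · simpa [hi] using hx.2 i

theorem ComponentwiseConcave.congr {g' : (Fin s → ℝ) → ℝ} (hg : ComponentwiseConcave g)
    (h : Set.EqOn g g' (Set.Icc 0 1)) : ComponentwiseConcave g' := fun x hx j =>
  (hg x hx j).congr fun _ ht => h (update_mem_box hx j ht)

theorem Submodular.congr {g' : (Fin s → ℝ) → ℝ} (hg : Submodular g)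
    (h : Set.EqOn g g' (Set.Icc 0 1)) : Submodular g' := by
  intro x hx y hy
  have := hg x hx y hy
  rwa [h hx, h hy, h ⟨le_inf hx.1 hy.1, inf_le_left.trans hx.2⟩,
    h ⟨hx.1.trans le_sup_left, sup_le hx.2 hy.2⟩] at this

/-- The increments in each coordinate decrease in the other coordinates. -/
def DecreasingDifferences (g : (Fin s → ℝ) → ℝ) : Prop :=
  ∀ x ∈ Set.Icc (0 : Fin s → ℝ) 1, ∀ y ∈ Set.Icc (0 : Fin s → ℝ) 1, y ≤ x →
    ∀ (j : Fin s) (a b : ℝ), 0 ≤ a → a ≤ b → b ≤ 1 →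
      g (Function.update x j b) - g (Function.update x j a) ≤
        g (Function.update y j b) - g (Function.update y j a)

/-- The increments decrease in the base point. -/
def DecreasingIncrements (g : (Fin s → ℝ) → ℝ) : Prop :=
  ∀ x y d : Fin s → ℝ, 0 ≤ y → y ≤ x → 0 ≤ d → x + d ≤ 1 →
    g (x + d) - g x ≤ g (y + d) - g y

theorem Submodular.decreasingDifferences (hg : Submodular g) : DecreasingDifferences g := by
  intro x hx y hy hyx j a b ha hab hb
  have h := hg (Function.update x j a) (update_mem_box hx j ⟨ha, hab.trans hb⟩)
    (Function.update y j b) (update_mem_box hy j ⟨ha.trans hab, hb⟩)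
  have e1 : Function.update x j a ⊓ Function.update y j b = Function.update y j a := by
    ext i; by_cases hi : i = j
    · subst hi; simpa using hab
    · simpa [hi] using hyx i
  have e2 : Function.update x j a ⊔ Function.update y j b = Function.update x j b := by
    ext i; by_cases hi : i = j
    · subst hi; simpa using hab
    · simpa [hi] using hyx i
  rw [e1, e2] at h
  linarith

/-- The increment `d` is added one coordinate at a time. In coordinate `j`, decreasing differences
lower the other coordinates of the base point from `x` to `y`, and concavity moves the interval from
`x j` down to `y j`. -/
theorem DecreasingDifferences.decreasingIncrements (hg : DecreasingDifferences g)
    (hc : ComponentwiseConcave g) : DecreasingIncrements g := by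
  intro x y d hy hyx hd hxd
  have hyd : y + d ≤ 1 := (add_le_add_left hyx d).trans hxd
  have key : ∀ T : Finset (Fin s), g (x + T.piecewise d 0) - g x ≤ g (y + T.piecewise d 0) - g y := by
    intro T
    induction T using Finset.induction_on with
    | empty => simp
    | insert j T hj ih =>
      have hT0 : 0 ≤ T.piecewise d 0 := Finset.le_piecewise_of_le_of_le _ hd le_rfl
      have hTd : T.piecewise d 0 ≤ d := Finset.piecewise_le_of_le_of_le _ le_rfl hd
      have upd : ∀ z : Fin s → ℝ, z + (insert j T).piecewise d 0 =
          Function.update (z + T.piecewise d 0) j (z j + d j) := by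
        intro z; ext i
        by_cases hi : i = j
        · subst hi; simp
        · simp [hi, Finset.piecewise]
      have upd' : ∀ z : Fin s → ℝ, z + T.piecewise d 0 =
          Function.update (z + T.piecewise d 0) j (z j) := by
        intro z; ext i
        by_cases hi : i = j
        · subst hi; simp [hj]
        · simp [hi]
      have hxb : x + T.piecewise d 0 ∈ Set.Icc (0 : Fin s → ℝ) 1 :=
        ⟨add_nonneg (hy.trans hyx) hT0, (add_le_add_right hTd x).trans hxd⟩
      have hyb : y + T.piecewise d 0 ∈ Set.Icc (0 : Fin s → ℝ) 1 :=
        ⟨add_nonneg hy hT0, (add_le_add_right hTd y).trans hyd⟩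
      have hxj : x j + d j ≤ 1 := hxd j
      have hyj : 0 ≤ y j := hy j
      have hdj : 0 ≤ d j := hd j
      have hxyj : y j ≤ x j := hyx j
      have h1 := hg _ hxb _ hyb (add_le_add_left hyx _) j (x j) (x j + d j)
        (hyj.trans hxyj) (by linarith) hxj
      have h2 := (hc _ hyb j).add_sub_le_add_sub (p := y j) (q := x j) (d := d j)
        ⟨hyj, by linarith⟩ hxyj hdj ⟨by linarith, hxj⟩
      rw [← upd, ← upd'] at h1
      rw [← upd, ← upd'] at h2
      linarith
  have := key Finset.univ
  rwa [Finset.piecewise_univ] at this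

/-- The increment `x - x ⊓ y` leads from `x ⊓ y` to `x` and from `y` to `x ⊔ y`. -/
theorem DecreasingIncrements.submodular (hg : DecreasingIncrements g) : Submodular g := by
  intro x hx y hy
  have h := hg y (x ⊓ y) (x - x ⊓ y) (le_inf hx.1 hy.1) inf_le_right (sub_nonneg.2 inf_le_left) ?_
  · have e1 : y + (x - x ⊓ y) = x ⊔ y := by
      have := inf_add_sup x y
      rw [eq_comm, ← sub_eq_iff_eq_add'] at this
      rw [← this]; abel
    have e2 : x ⊓ y + (x - x ⊓ y) = x := by abel
    rw [e1, e2] at h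
    linarith
  · intro i
    simp only [Pi.add_apply, Pi.sub_apply, Pi.inf_apply, Pi.one_apply]
    have h1 := hx.2 i
    have h2 := hy.2 i
    simp only [Pi.one_apply] at h1 h2
    rcases le_total (x i) (y i) with h | h
    · rw [min_eq_left h]; linarith
    · rw [min_eq_right h]; linarith

/-- Comparison of increments in each coordinate at small scales, with a shift. -/
def LocallyDecreasing (g : (Fin s → ℝ) → ℝ) : Prop :=
  ∀ x ∈ Set.Icc (0 : Fin s → ℝ) 1, ∀ y ∈ Set.Icc (0 : Fin s → ℝ) 1, y ≤ x →
    ∀ (j : Fin s) (t d : ℝ), 0 ≤ d → 0 ≤ t - 2 * d → t + 2 * d ≤ 1 →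
      g (Function.update x j (t + d)) - g (Function.update x j t) ≤
        g (Function.update y j t) - g (Function.update y j (t - d))

/-- With both base points equal, the local inequality is midpoint concavity. -/
theorem LocallyDecreasing.componentwiseConcave (hg : LocallyDecreasing g) (hgc : Continuous g) :
    ComponentwiseConcave g := fun x hx j =>
  concaveOn_of_local_midpoint (hgc.comp (continuous_const.update j continuous_id))
    fun t d h0 h1 h2 => by
      have := hg x hx x hx le_rfl j t d h0 h1 h2
      linarith

theorem LocallyDecreasing.submodular (hg : LocallyDecreasing g) (hgc : Continuous g) :
    Submodular g :=
  DecreasingIncrements.submodular <| DecreasingDifferences.decreasingIncrements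
    (fun x hx y hy hyx j _ _ ha hab hb =>
      sub_le_sub_of_local (hgc.comp (continuous_const.update j continuous_id))
        (hgc.comp (continuous_const.update j continuous_id))
        (fun t d h0 h1 h2 => hg x hx y hy hyx j t d h0 h1 h2) ha hab hb)
    (hg.componentwiseConcave hgc)

end Box

/-! ### From quasi-convexity to the local inequality. -/

section QuasiConvexity

variable {Ω : Type*} [MeasurableSpace Ω] {P : Measure Ω} {s : ℕ} {S : Fin s → Set Ω} {n : ℕ}
  {I : RatingCriterion Ω n} {ρ : BddRV Ω → ℝ} {ν : Set Ω → ℝ}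

theorem IsCapacity.choquet_mix_ind (hν : IsCapacity ν) {A B : Set Ω} (hA : MeasurableSet A)
    (hB : MeasurableSet B) (h : (1 / 2 : ℝ) ∈ Set.Icc (0 : ℝ) 1) :
    choquet ν (Loss.mix (1 / 2) h (Loss.ind A hA) (Loss.ind B hB)).toBdd =
      (ν (A ∪ B) + ν (A ∩ B)) / 2 := by
  have hval : ∀ ω, Loss.mix (1 / 2) h (Loss.ind A hA) (Loss.ind B hB) ω =
      1 / 2 * A.indicator 1 ω + (1 - 1 / 2) * B.indicator 1 ω := fun _ => rfl
  refine hν.choquet_two_step _ (fun x hx => ?_) fun x hx => ?_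
  all_goals
    obtain ⟨h0, h1⟩ := hx
    ext ω
    rw [Loss.mem_above, hval]
    by_cases hωA : ω ∈ A <;> by_cases hωB : ω ∈ B <;> simp [hωA, hωB] <;> linarith

/-- The half-half mixture of the two indicators has risk `(ν (A ∪ B) + ν (A ∩ B)) / 2`. If
submodularity failed, rescaling would put both indicators below the threshold and their mixture
above it. -/
theorem QuasiConvex.submodular_capacity (hI : QuasiConvex I) (hρ : IsChoquetRepresentation I ρ)
    (hν : IsCapacity ν) (hρν : ∀ X, ρ X = choquet ν X) {A B : Set Ω} (hA : MeasurableSet A)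
    (hB : MeasurableSet B) : ν (A ∪ B) + ν (A ∩ B) ≤ ν A + ν B := by
  by_contra! hlt
  obtain ⟨c, ⟨hc0, hc1⟩, hc⟩ := hρ.exists_threshold
  have half : (1 / 2 : ℝ) ∈ Set.Icc (0 : ℝ) 1 := by constructor <;> norm_num
  have hA0 := hν.nonneg hA
  have hA1 := hν.le_one hA
  have hB0 := hν.nonneg hB
  have hB1 := hν.le_one hB
  have hu1 := hν.le_one (hA.union hB)
  have hi1 := hν.le_one (hA.inter hB)
  have hi0 := hν.nonneg (hA.inter hB)
  have hu0 := hν.nonneg (hA.union hB)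
  -- Halfway between the average risk of the indicators and the risk of their mixture; it is sent to
  -- `c`.
  set m := (ν A + ν B + (ν (A ∪ B) + ν (A ∩ B))) / 4 with hm
  set a := min c (1 - c) / 3 with ha
  have ha0 : 0 < a := by
    have : 0 < min c (1 - c) := lt_min hc0 (by linarith)
    linarith
  have hac : 3 * a ≤ c := by linarith [min_le_left c (1 - c)]
  have hac' : 3 * a ≤ 1 - c := by linarith [min_le_right c (1 - c)]
  have am0 : 0 ≤ a * m := mul_nonneg ha0.le (by linarith)
  have am1 : a * m ≤ a := by nlinarith
  have aA0 : 0 ≤ a * ν A := mul_nonneg ha0.le hA0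
  have aA1 : a * ν A ≤ a := by nlinarith
  have aB0 : 0 ≤ a * ν B := mul_nonneg ha0.le hB0
  have aB1 : a * ν B ≤ a := by nlinarith
  -- The offsets `b` and `b'` equalise the risks of `X` and `Y` although `ν A` and `ν B` may differ,
  -- so the maximum in quasi-convexity costs nothing. The divisor 3 in `a` leaves room for them.
  set b := c - a * m + (a * ν B - a * ν A) / 2 with hb
  set b' := c - a * m + (a * ν A - a * ν B) / 2 with hb'
  have b0 : 0 ≤ b := by linarith
  have b0' : 0 ≤ b' := by linarith
  have b1 : a + b ≤ 1 := by linarith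
  have b1' : a + b' ≤ 1 := by linarith
  let X := (Loss.ind A hA).affine a b ha0.le b0 b1
  let Y := (Loss.ind B hB).affine a b' ha0.le b0' b1'
  have hmix : Loss.mix (1 / 2) half X Y =
      (Loss.mix (1 / 2) half (Loss.ind A hA) (Loss.ind B hB)).affine a ((b + b') / 2) ha0.le
        (by linarith) (by linarith) := by
    refine Loss.ext fun ω => ?_
    change 1 / 2 * (a * A.indicator 1 ω + b) + (1 - 1 / 2) * (a * B.indicator 1 ω + b') =
      a * (1 / 2 * A.indicator 1 ω + (1 - 1 / 2) * B.indicator 1 ω) + (b + b') / 2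
    ring
  have hgap : a * ((ν A + ν B) / 2) < a * m := mul_lt_mul_of_pos_left (by linarith) ha0
  have hgap' : a * m < a * ((ν (A ∪ B) + ν (A ∩ B)) / 2) :=
    mul_lt_mul_of_pos_left (by linarith) ha0
  have hX : ρ X.toBdd < c := by
    rw [hρ.rho_affine ha0, hρν, hν.choquet_ind]; linarith
  have hY : ρ Y.toBdd < c := by
    rw [hρ.rho_affine ha0, hρν, hν.choquet_ind]; linarith
  have hXY : c < ρ (Loss.mix (1 / 2) half X Y).toBdd := by
    rw [hmix, hρ.rho_affine ha0, hρν, hν.choquet_mix_ind]; linarith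
  exact absurd (hI X Y (1 / 2) half) (not_le.2 (max_lt (hc _ _ hX hXY) (hc _ _ hY hXY)))

variable {U : Ω → unitInterval}

/-- Submodularity is applied to `E2` and `E1 ∪ E3 \ E2`, whose union is `E3` and intersection `E1`.
The set `E3 \ E2` adds mass `d` in scenario `j` and nothing elsewhere, so the second event has the
probabilities of `y` with `t` in coordinate `j`. -/
theorem IsScenarios.locallyDecreasing_lower [IsProbabilityMeasure P] (hS : IsScenarios P S)
    (hU : IsUniform P S U) (hρ : IsChoquetRepresentation I ρ) (hLI : SLawInvariant P S I)
    (hν : IsCapacity ν) (hρν : ∀ X, ρ X = choquet ν X)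
    (hsub : ∀ A B : Set Ω, MeasurableSet A → MeasurableSet B → ν (A ∪ B) + ν (A ∩ B) ≤ ν A + ν B) :
    LocallyDecreasing fun x => ν (hS.lower U x) := by
  have hprob := hS.isProbabilityMeasure_cond
  intro x hx y hy hyx j t d hd h0 h1
  simp only
  have hmem : ∀ z ∈ Set.Icc (0 : Fin s → ℝ) 1, ∀ r, 0 ≤ r → r ≤ 1 →
      scenarioProb P S (hS.lower U (Function.update z j r)) = Function.update z j r :=
    fun z hz r hr0 hr1 => hS.scenarioProb_lower hU (update_mem_box hz j ⟨hr0, hr1⟩)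
  set E1 := hS.lower U (Function.update y j (t - d))
  set E2 := hS.lower U (Function.update x j t)
  set E3 := hS.lower U (Function.update x j (t + d))
  have m1 : MeasurableSet E1 := hS.measurableSet_lower hU _
  have m2 : MeasurableSet E2 := hS.measurableSet_lower hU _
  have m3 : MeasurableSet E3 := hS.measurableSet_lower hU _
  have h12 : E1 ⊆ E2 := hS.lower_mono U (update_le_update_iff.2
    ⟨by linarith, fun i _ => hyx i⟩)
  have h23 : E2 ⊆ E3 := hS.lower_mono U (update_le_update_iff.2
    ⟨by linarith, fun i _ => le_rfl⟩)
  have hdisj : Disjoint E1 (E3 \ E2) := by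
    rw [Set.disjoint_left]; intro ω a b; exact b.2 (h12 a)
  have hA : ν (E1 ∪ E3 \ E2) = ν (hS.lower U (Function.update y j t)) := by
    refine hρ.capacity_eq hS hLI hν hρν (m1.union (m3.diff m2)) (hS.measurableSet_lower hU _) ?_
    rw [hmem y hy t (by linarith) (by linarith)]
    ext i
    have e1 := congrFun (hmem y hy (t - d) (by linarith) (by linarith)) i
    have e2 := congrFun (hmem x hx t (by linarith) (by linarith)) i
    have e3 := congrFun (hmem x hx (t + d) (by linarith) (by linarith)) i
    simp only [scenarioProb] at e1 e2 e3 ⊢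
    rw [measureReal_union hdisj (m3.diff m2), measureReal_sdiff h23 m2, e1, e2, e3]
    by_cases hi : i = j
    · subst hi; simp only [Function.update_self]; ring
    · simp [hi]
  have h := hsub (E1 ∪ E3 \ E2) E2 (m1.union (m3.diff m2)) m2
  have e1 : (E1 ∪ E3 \ E2) ∪ E2 = E3 := by
    ext ω; constructor
    · rintro ((h | h) | h)
      · exact h23 (h12 h)
      · exact h.1
      · exact h23 h
    · intro h
      by_cases h' : ω ∈ E2
      · exact Or.inr h'
      · exact Or.inl (Or.inr ⟨h, h'⟩)
  have e2 : (E1 ∪ E3 \ E2) ∩ E2 = E1 := by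
    ext ω; constructor
    · rintro ⟨h | h, h'⟩
      · exact h
      · exact absurd h' h.2
    · exact fun h => ⟨Or.inl h, h12 h⟩
  rw [e1, e2, hA] at h
  linarith

end QuasiConvexity

/-! ### Conditionally iid sequences from mixtures. -/

section CondIID

variable {Ω : Type*} [MeasurableSpace Ω] {Q : Measure Ω} [IsProbabilityMeasure Q]

theorem measureReal_prod_infinitePi {α β : Type*} [MeasurableSpace α] [MeasurableSpace β]
    {μ : Measure α} {κ : Measure β} [IsProbabilityMeasure μ] [IsProbabilityMeasure κ]
    {ψ : α × β → ℝ} (hψ : Measurable ψ) (F : Finset ℕ) {B : ℕ → Set ℝ}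
    (hB : ∀ i, MeasurableSet (B i)) {C : Set α} (hC : MeasurableSet C) :
    (μ.prod (Measure.infinitePi fun _ : ℕ => κ)).real
        {v | v.1 ∈ C ∧ ∀ i ∈ F, ψ (v.1, v.2 i) ∈ B i} =
      ∫ z in C, ∏ i ∈ F, κ.real {w | ψ (z, w) ∈ B i} ∂μ := by
  set T : Set (α × (ℕ → β)) := {v | v.1 ∈ C ∧ ∀ i ∈ F, ψ (v.1, v.2 i) ∈ B i} with hT
  have hTm : MeasurableSet T := by
    have : T = (Prod.fst ⁻¹' C) ∩ ⋂ i ∈ F, (fun v : α × (ℕ → β) => ψ (v.1, v.2 i)) ⁻¹' B i := by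
      ext v; simp [hT]
    rw [this]
    refine (measurable_fst hC).inter (Finset.measurableSet_biInter F fun i _ => ?_)
    exact (hψ.comp (by fun_prop)) (hB i)
  have hslice : ∀ z, (Measure.infinitePi fun _ : ℕ => κ).real (Prod.mk z ⁻¹' T) =
      C.indicator (fun z => ∏ i ∈ F, κ.real {w | ψ (z, w) ∈ B i}) z := by
    intro z
    by_cases hz : z ∈ C
    · have : Prod.mk z ⁻¹' T = Set.pi F fun i => {w | ψ (z, w) ∈ B i} := by
        ext w; simp [hT, hz, Set.mem_pi]
      have hm : ∀ i ∈ F, MeasurableSet {w | ψ (z, w) ∈ B i} := fun i _ =>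
        (hψ.comp measurable_prodMk_left) (hB i)
      rw [this, Set.indicator_of_mem hz, Measure.real, Measure.infinitePi_pi _ hm,
        ENNReal.toReal_prod]
      rfl
    · have : Prod.mk z ⁻¹' T = ∅ := by
        ext w; simp [hT, hz]
      rw [this, Set.indicator_of_notMem hz]; simp
  rw [Measure.real, Measure.prod_apply hTm, ← integral_toReal
    (measurable_measure_prodMk_left hTm).aemeasurable
    (Filter.Eventually.of_forall fun z => measure_lt_top _ _), ← integral_indicator hC]
  exact integral_congr_ae (Filter.Eventually.of_forall hslice)

/-- Mixtures of an iid sequence with an independent random variable are conditionally iid. -/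
theorem isCondIID_of_map_eq {μ κ : Measure unitInterval} [IsProbabilityMeasure μ]
    [IsProbabilityMeasure κ] {V : Ω → unitInterval × (ℕ → unitInterval)} (hV : Measurable V)
    (hVQ : Q.map V = μ.prod (Measure.infinitePi fun _ : ℕ => κ))
    {ψ : unitInterval × unitInterval → ℝ} (hψ : Measurable ψ) {L : ℕ → Loss Ω}
    (hL : ∀ i, ∀ᵐ ω ∂Q, L i ω = ψ ((V ω).1, (V ω).2 i)) : IsCondIID Q L := by
  let Z : Ω → Fin 1 → ℝ := fun ω _ => ((V ω).1 : ℝ)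
  have hZ : Measurable Z := measurable_pi_lambda _ fun _ => hV.fst.subtype_val
  let p : Set ℝ → unitInterval → ℝ := fun B z => κ.real {w | ψ (z, w) ∈ B}
  have hp : ∀ B, MeasurableSet B → Measurable (p B) := fun B hB =>
    (measurable_measure_prodMk_left (hψ hB)).ennreal_toReal
  have hVm : Measurable[MeasurableSpace.comap Z inferInstance] fun ω => (V ω).1 := by
    have h1 : Measurable fun z : Fin 1 → ℝ => Set.projIcc (0 : ℝ) 1 zero_le_one (z 0) := by
      exact continuous_projIcc.measurable.comp (measurable_pi_apply 0)
    have h2 := h1.comp (comap_measurable Z)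
    have h3 : (fun z : Fin 1 → ℝ => Set.projIcc (0 : ℝ) 1 zero_le_one (z 0)) ∘ Z =
        fun ω => (V ω).1 := by
      funext ω; exact Set.projIcc_val zero_le_one _
    rwa [h3] at h2
  have hm := hZ.comap_le
  -- Given the first component of `V`, the remaining coordinates are iid; by Fubini the joint
  -- conditional probability is the product of the slices `p (B i)`.
  have key : ∀ (F : Finset ℕ) (B : ℕ → Set ℝ), (∀ i, MeasurableSet (B i)) →
      Q⟦⋂ i ∈ F, (L i : Ω → ℝ) ⁻¹' B i | MeasurableSpace.comap Z inferInstance⟧ =ᵐ[Q]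
        fun ω => ∏ i ∈ F, p (B i) (V ω).1 := by
    intro F B hB
    have hA : MeasurableSet (⋂ i ∈ F, (L i : Ω → ℝ) ⁻¹' B i) :=
      Finset.measurableSet_biInter F fun i _ => (L i).measurable (hB i)
    have hprod : Measurable fun z => ∏ i ∈ F, p (B i) z :=
      Finset.measurable_fun_prod F fun i _ => hp _ (hB i)
    have hbd : ∀ z, |∏ i ∈ F, p (B i) z| ≤ 1 := fun z => by
      rw [abs_of_nonneg (Finset.prod_nonneg fun i _ => measureReal_nonneg)]
      exact Finset.prod_le_one (fun i _ => measureReal_nonneg) fun i _ => measureReal_le_one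
    have hint : Integrable (fun ω => ∏ i ∈ F, p (B i) (V ω).1) Q :=
      Integrable.of_bound (hprod.comp hV.fst).aestronglyMeasurable 1
        (Filter.Eventually.of_forall fun ω => hbd _)
    refine (ae_eq_condExp_of_forall_setIntegral_eq hm ((integrable_const (1 : ℝ)).indicator hA)
      (fun _ _ _ => hint.integrableOn) (fun T hT _ => ?_)
      (hprod.comp hVm).stronglyMeasurable.aestronglyMeasurable).symm
    obtain ⟨C, hC, rfl⟩ := hT
    let C' : Set unitInterval := {z | (fun _ => (z : ℝ)) ∈ C}
    have hC' : MeasurableSet C' := by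
      have : Measurable fun (z : unitInterval) (_ : Fin 1) => (z : ℝ) := by fun_prop
      exact this hC
    have hfst : Q.map (fun ω => (V ω).1) = μ := by
      have : (fun ω => (V ω).1) = Prod.fst ∘ V := rfl
      rw [this, ← Measure.map_map measurable_fst hV, hVQ, Measure.map_fst_prod]
      simp
    have e1 : ∫ ω in Z ⁻¹' C, ∏ i ∈ F, p (B i) (V ω).1 ∂Q = ∫ z in C', ∏ i ∈ F, p (B i) z ∂μ := by
      rw [← hfst, setIntegral_map hC' hprod.aestronglyMeasurable hV.fst.aemeasurable]
      rfl
    have e2 : ∫ ω in Z ⁻¹' C, (⋂ i ∈ F, (L i : Ω → ℝ) ⁻¹' B i).indicator (fun _ => (1 : ℝ)) ω ∂Q =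
        Q.real (Z ⁻¹' C ∩ ⋂ i ∈ F, (L i : Ω → ℝ) ⁻¹' B i) := by
      rw [setIntegral_indicator hA, setIntegral_const, smul_eq_mul, mul_one]
    rw [e1, e2]
    have e3 := measureReal_prod_infinitePi (μ := μ) (κ := κ) hψ F hB hC'
    rw [← e3, ← hVQ, map_measureReal_apply hV]
    · refine measureReal_congr ?_
      filter_upwards [ae_all_iff.2 hL] with ω hω
      refine propext ?_
      change ((V ω).1 ∈ C' ∧ ∀ i ∈ F, ψ ((V ω).1, (V ω).2 i) ∈ B i) ↔
        (Z ω ∈ C ∧ ω ∈ ⋂ i ∈ F, (L i : Ω → ℝ) ⁻¹' B i)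
      simp only [Set.mem_iInter, Set.mem_preimage, hω]
      exact Iff.rfl
    · have : {v : unitInterval × (ℕ → unitInterval) | v.1 ∈ C' ∧ ∀ i ∈ F, ψ (v.1, v.2 i) ∈ B i} =
        (Prod.fst ⁻¹' C') ∩ ⋂ i ∈ F,
          (fun v : unitInterval × (ℕ → unitInterval) => ψ (v.1, v.2 i)) ⁻¹' B i := by
        ext v; simp
      rw [this]
      refine (measurable_fst hC').inter (Finset.measurableSet_biInter F fun i _ => ?_)
      exact (hψ.comp (by fun_prop)) (hB i)
  have key1 : ∀ (i : ℕ) (B : Set ℝ), MeasurableSet B →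
      Q⟦(L i : Ω → ℝ) ⁻¹' B | MeasurableSpace.comap Z inferInstance⟧ =ᵐ[Q]
        fun ω => p B (V ω).1 := by
    intro i B hB
    have := key {i} (fun _ => B) fun _ => hB
    simpa using! this
  refine ⟨1, Z, hZ, fun F B hB => ?_, fun i k B hB => (key1 i B hB).trans (key1 k B hB).symm⟩
  refine (key F B hB).trans ?_
  have hall : ∀ᵐ ω ∂Q, ∀ i ∈ F,
      (Q⟦(L i : Ω → ℝ) ⁻¹' B i | MeasurableSpace.comap Z inferInstance⟧) ω = p (B i) (V ω).1 := by
    rw [Filter.eventually_all_finset]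
    exact fun i _ => key1 i (B i) (hB i)
  filter_upwards [hall] with ω hω
  rw [Finset.prod_apply]
  exact Finset.prod_congr rfl fun i hi => (hω i hi).symm

end CondIID

/-! ### From pooling effect consistency to the local inequality. -/

section PoolingEffect

variable {Ω : Type*} [MeasurableSpace Ω] {P : Measure Ω} {s : ℕ} {S : Fin s → Set Ω} {n : ℕ}
  {I : RatingCriterion Ω n} {ρ : BddRV Ω → ℝ} {ν : Set Ω → ℝ}

/-- A sequence of independent uniformly distributed random variables. -/
noncomputable def uniformSeq : Measure (ℕ → unitInterval) := Measure.infinitePi fun _ => volume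

instance : IsProbabilityMeasure uniformSeq := by unfold uniformSeq; infer_instance

/-- The coin that falls heads if the `i`-th uniform variable is smaller than `1 / 2`. -/
def coin (i : ℕ) : Set (ℕ → unitInterval) := {w | (w i : ℝ) < 1 / 2}

theorem measurableSet_coin (i : ℕ) : MeasurableSet (coin i) :=
  measurableSet_lt (measurable_pi_apply i).subtype_val measurable_const

theorem volume_lt_half : volume {w : unitInterval | (w : ℝ) < 1 / 2} = ENNReal.ofReal (1 / 2) :=
  unitInterval.volume_Iio ⟨1 / 2, by norm_num, by norm_num⟩

theorem uniformSeq_real_coins (F : Finset ℕ) :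
    uniformSeq.real {w | ∀ i ∈ F, w ∈ coin i} = (1 / 2) ^ F.card := by
  have h : {w | ∀ i ∈ F, w ∈ coin i} =
      Set.pi F fun _ => {w : unitInterval | (w : ℝ) < 1 / 2} := by
    ext w; simp [coin, Set.mem_pi]
  have hm : ∀ i ∈ F, MeasurableSet {w : unitInterval | (w : ℝ) < 1 / 2} := fun _ _ =>
    measurableSet_lt measurable_subtype_coe measurable_const
  rw [h, Measure.real, uniformSeq, Measure.infinitePi_pi _ hm, Finset.prod_const, volume_lt_half,
    ENNReal.toReal_pow, ENNReal.toReal_ofReal (by norm_num)]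

theorem uniformSeq_real_coin (i : ℕ) : uniformSeq.real (coin i) = 1 / 2 := by
  simpa using! uniformSeq_real_coins {i}

theorem uniformSeq_real_inter : uniformSeq.real (coin 0 ∩ coin 1) = 1 / 4 := by
  have h := uniformSeq_real_coins {0, 1}
  have e : {w | ∀ i ∈ ({0, 1} : Finset ℕ), w ∈ coin i} = coin 0 ∩ coin 1 := by
    ext w; simp
  rw [e] at h
  rw [h]; norm_num

theorem uniformSeq_real_union : uniformSeq.real (coin 0 ∪ coin 1) = 3 / 4 := by
  have h := measureReal_union_add_inter (μ := uniformSeq) (s := coin 0) (measurableSet_coin 1)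
  rw [uniformSeq_real_coin, uniformSeq_real_coin, uniformSeq_real_inter] at h
  linarith

/-- The event that, in scenario `j`, the uniform variable is below `a`, or it is below `b` and
the coins fall in `H`, and that, in the other scenarios `k`, the uniform variable is below `z k`. -/
def IsScenarios.mixEvent (hS : IsScenarios P S) (V : Ω → unitInterval × (ℕ → unitInterval))
    (j : Fin s) (a b : ℝ) (z : Fin s → ℝ) (H : Set (ℕ → unitInterval)) : Set Ω :=
  {ω | (hS.index ω = j ∧ (((V ω).1 : ℝ) < a ∨ (((V ω).1 : ℝ) < b ∧ (V ω).2 ∈ H))) ∨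
    (hS.index ω ≠ j ∧ ((V ω).1 : ℝ) < z (hS.index ω))}

variable {V : Ω → unitInterval × (ℕ → unitInterval)}

theorem IsScenarios.measurableSet_mixEvent (hS : IsScenarios P S) (hV : Measurable V) (j : Fin s)
    (a b : ℝ) (z : Fin s → ℝ) {H : Set (ℕ → unitInterval)} (hH : MeasurableSet H) :
    MeasurableSet (hS.mixEvent V j a b z H) := by
  have h1 : MeasurableSet {ω | hS.index ω = j} := hS.measurable_index (measurableSet_singleton j)
  have hU : ∀ c : ℝ, MeasurableSet {ω | ((V ω).1 : ℝ) < c} := fun c =>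
    measurableSet_lt hV.fst.subtype_val measurable_const
  refine MeasurableSet.union (h1.inter ((hU a).union ((hU b).inter (hV.snd hH))))
    (h1.compl.inter ?_)
  exact measurableSet_lt hV.fst.subtype_val ((measurable_of_countable z).comp hS.measurable_index)

theorem isUniform_fst (hV : Measurable V)
    (hVP : ∀ j, (cond P (S j)).map V = (volume : Measure unitInterval).prod uniformSeq) :
    IsUniform P S fun ω => (V ω).1 := by
  refine ⟨hV.fst, fun j => ?_⟩
  have : (fun ω => (V ω).1) = Prod.fst ∘ V := rfl
  rw [this, ← Measure.map_map measurable_fst hV, hVP, Measure.map_fst_prod]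
  simp

theorem IsScenarios.scenarioProb_mixEvent [IsProbabilityMeasure P] (hS : IsScenarios P S)
    (hV : Measurable V)
    (hVP : ∀ j, (cond P (S j)).map V = (volume : Measure unitInterval).prod uniformSeq)
    (j : Fin s) {a b : ℝ} (ha : 0 ≤ a) (hab : a ≤ b) (hb : b ≤ 1) {z : Fin s → ℝ}
    (hz : z ∈ Set.Icc (0 : Fin s → ℝ) 1) {H : Set (ℕ → unitInterval)} (hH : MeasurableSet H) :
    scenarioProb P S (hS.mixEvent V j a b z H) =
      Function.update z j (a + (b - a) * uniformSeq.real H) := by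
  have hprob := hS.isProbabilityMeasure_cond
  have hU := isUniform_fst hV hVP
  ext k
  by_cases hk : k = j
  · subst hk
    rw [Function.update_self]
    let a' : unitInterval := ⟨a, ha, hab.trans hb⟩
    let b' : unitInterval := ⟨b, ha.trans hab, hb⟩
    -- Up to a null set the event is the preimage of two disjoint rectangles, whose product measures
    -- are `a` and `(b - a)` times the probability of `H`.
    have h1 : scenarioProb P S (hS.mixEvent V k a b z H) k =
        ((cond P (S k)).map V).real ((Set.Iio a' ×ˢ Set.univ) ∪ (Set.Ico a' b' ×ˢ H)) := by
      rw [map_measureReal_apply hV ((measurableSet_Iio.prod MeasurableSet.univ).union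
        (measurableSet_Ico.prod hH))]
      refine measureReal_congr ?_
      filter_upwards [hS.ae_index_eq k] with ω hω
      refine propext ?_
      change ((hS.index ω = k ∧ (((V ω).1 : ℝ) < a ∨ (((V ω).1 : ℝ) < b ∧ (V ω).2 ∈ H))) ∨
        (hS.index ω ≠ k ∧ ((V ω).1 : ℝ) < z (hS.index ω))) ↔
        ((((V ω).1 : ℝ) < a ∧ True) ∨ ((a ≤ ((V ω).1 : ℝ) ∧ ((V ω).1 : ℝ) < b) ∧ (V ω).2 ∈ H))
      simp only [hω, true_and, ne_eq, not_true, false_and, or_false, and_true]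
      rcases lt_or_ge ((V ω).1 : ℝ) a with h | h
      · simp [h]
      · simp [h, h.not_gt]
    have hdisj : Disjoint (Set.Iio a' ×ˢ (Set.univ : Set (ℕ → unitInterval)))
        (Set.Ico a' b' ×ˢ H) := by
      rw [Set.disjoint_left]
      rintro ⟨u, w⟩ ⟨h1, -⟩ ⟨h2, -⟩
      exact absurd h1 (not_lt.2 h2.1)
    rw [h1, hVP, measureReal_union hdisj (measurableSet_Ico.prod hH), measureReal_prod_prod,
      measureReal_prod_prod]
    simp only [Measure.real, unitInterval.volume_Iio, unitInterval.volume_Ico, measure_univ,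
      ENNReal.toReal_one, mul_one]
    rw [ENNReal.toReal_ofReal ha, ENNReal.toReal_ofReal (sub_nonneg.2 hab)]
  · rw [Function.update_of_ne hk, ← hU.measureReal_lt k ⟨hz.1 k, hz.2 k⟩]
    refine measureReal_congr ?_
    filter_upwards [hS.ae_index_eq k] with ω hω
    refine propext ?_
    change ((hS.index ω = j ∧ (((V ω).1 : ℝ) < a ∨ (((V ω).1 : ℝ) < b ∧ (V ω).2 ∈ H))) ∨
        (hS.index ω ≠ j ∧ ((V ω).1 : ℝ) < z (hS.index ω))) ↔ ((V ω).1 : ℝ) < z k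
    simp [hω, hk]

open Classical in
/-- The value of the losses of a pool that is diversified only in scenario `j`. -/
noncomputable def mixValue (j : Fin s) (a b : ℝ) (x y : Fin s → ℝ) (k : Fin s)
    (v : unitInterval × unitInterval) : ℝ :=
  if k = j then if (v.1 : ℝ) < a ∨ ((v.1 : ℝ) < b ∧ (v.2 : ℝ) < 1 / 2) then 1 else 0
  else (if (v.1 : ℝ) < x k then 1 / 2 else 0) + if (v.1 : ℝ) < y k then 1 / 2 else 0

theorem measurable_mixValue (j : Fin s) (a b : ℝ) (x y : Fin s → ℝ) (k : Fin s) :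
    Measurable (mixValue j a b x y k) := by
  have h1 : ∀ c : ℝ, MeasurableSet {v : unitInterval × unitInterval | (v.1 : ℝ) < c} := fun c =>
    measurableSet_lt measurable_fst.subtype_val measurable_const
  have h2 : ∀ c : ℝ, MeasurableSet {v : unitInterval × unitInterval | (v.2 : ℝ) < c} := fun c =>
    measurableSet_lt measurable_snd.subtype_val measurable_const
  by_cases hk : k = j
  · have : mixValue j a b x y k =
        fun v => if (v.1 : ℝ) < a ∨ ((v.1 : ℝ) < b ∧ (v.2 : ℝ) < 1 / 2) then 1 else 0 := by
      funext v; simp [mixValue, hk]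
    rw [this]
    exact Measurable.ite ((h1 a).union ((h1 b).inter (h2 _))) measurable_const measurable_const
  · have : mixValue j a b x y k =
        fun v => (if (v.1 : ℝ) < x k then 1 / 2 else 0) + if (v.1 : ℝ) < y k then 1 / 2 else 0 := by
      funext v; simp [mixValue, hk]
    rw [this]
    exact (Measurable.ite (h1 _) measurable_const measurable_const).add
      (Measurable.ite (h1 _) measurable_const measurable_const)

theorem mixValue_mem_Icc (j : Fin s) (a b : ℝ) (x y : Fin s → ℝ) (k : Fin s)
    (v : unitInterval × unitInterval) : mixValue j a b x y k v ∈ Set.Icc (0 : ℝ) 1 := by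
  unfold mixValue
  split_ifs <;> constructor <;> norm_num

/-- The losses of a pool that is diversified only in scenario `j`. -/
noncomputable def IsScenarios.mixLoss (hS : IsScenarios P S) (hV : Measurable V) (j : Fin s)
    (a b : ℝ) (x y : Fin s → ℝ) (i : ℕ) : Loss Ω :=
  ⟨fun ω => mixValue j a b x y (hS.index ω) ((V ω).1, (V ω).2 i), by
    have h : Measurable (Function.uncurry (mixValue j a b x y)) :=
      measurable_from_prod_countable_right (measurable_mixValue j a b x y)
    exact h.comp (hS.measurable_index.prodMk (hV.fst.prodMk
      ((measurable_pi_apply i).comp hV.snd))), fun ω => mixValue_mem_Icc _ _ _ _ _ _ _⟩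

theorem IsScenarios.mixLoss_apply (hS : IsScenarios P S) (hV : Measurable V) (j : Fin s)
    (a b : ℝ) (x y : Fin s → ℝ) (i : ℕ) (ω : Ω) : hS.mixLoss hV j a b x y i ω =
      mixValue j a b x y (hS.index ω) ((V ω).1, (V ω).2 i) := rfl

theorem Loss.tranche_zero (h : (0 : ℝ) ∈ Set.Ico (0 : ℝ) 1) (X : Loss Ω) :
    Loss.tranche 0 h X = X := Loss.ext fun ω => by
  change max (X ω - 0) 0 / (1 - 0) = X ω
  rw [sub_zero, sub_zero, div_one, max_eq_left (X.nonneg ω)]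

theorem Loss.pool_affine {a b : ℝ} (ha : 0 ≤ a) (hb : 0 ≤ b) (hab : a + b ≤ 1) (L : ℕ → Loss Ω)
    {l : ℕ} (hl : 1 ≤ l) :
    Loss.pool (fun i => (L i).affine a b ha hb hab) l = (Loss.pool L l).affine a b ha hb hab :=
  Loss.ext fun ω => by
    change (∑ i ∈ Finset.range l, (a * L i ω + b)) / (l : ℝ) =
      a * ((∑ i ∈ Finset.range l, L i ω) / (l : ℝ)) + b
    have : (l : ℝ) ≠ 0 := by positivity
    rw [Finset.sum_add_distrib, ← Finset.mul_sum, Finset.sum_const, Finset.card_range, nsmul_eq_mul]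
    field_simp

theorem Loss.pool_one (L : ℕ → Loss Ω) : Loss.pool L 1 = L 0 := Loss.ext fun ω => by
  change (∑ i ∈ Finset.range 1, L i ω) / ((1 : ℕ) : ℝ) = L 0 ω
  simp

theorem Loss.pool_two_apply (L : ℕ → Loss Ω) (ω : Ω) :
    Loss.pool L 2 ω = (L 0 ω + L 1 ω) / 2 := by
  change (∑ i ∈ Finset.range 2, L i ω) / ((2 : ℕ) : ℝ) = _
  simp [Finset.sum_range_succ]

/-- Pooling commutes with affine rescaling and the rescaled losses stay conditionally iid, so the
comparison of ratings at attachment point 0 for pools of sizes 1 and 2 passes to the risks. -/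
theorem SPoolingEffect.rho_pool_two_le (hI : SPoolingEffect P S I) [IsProbabilityMeasure P]
    (hS : IsScenarios P S) (hρ : IsChoquetRepresentation I ρ) (hV : Measurable V)
    (hVP : ∀ j, (cond P (S j)).map V = (volume : Measure unitInterval).prod uniformSeq)
    (j : Fin s) (a b : ℝ) (x y : Fin s → ℝ) :
    ρ (Loss.pool (hS.mixLoss hV j a b x y) 2).toBdd ≤ ρ (hS.mixLoss hV j a b x y 0).toBdd := by
  have hprob := hS.isProbabilityMeasure_cond
  refine hρ.rho_le_of_rate_affine_le fun c d hc hd hcd => ?_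
  have h0 : (0 : ℝ) ∈ Set.Ico (0 : ℝ) 1 := ⟨le_rfl, one_pos⟩
  have h := hI (fun i => (hS.mixLoss hV j a b x y i).affine c d hc.le hd hcd) (fun k => ?_)
    1 2 le_rfl one_le_two 0 h0
  · rwa [Loss.tranche_zero, Loss.tranche_zero, Loss.pool_affine _ _ _ _ one_le_two,
      Loss.pool_affine _ _ _ _ le_rfl, Loss.pool_one] at h
  · refine isCondIID_of_map_eq hV (hVP k)
      (ψ := fun v => c * mixValue j a b x y k v + d)
      (((measurable_mixValue j a b x y k).const_mul c).add_const d) fun i => ?_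
    filter_upwards [hS.ae_index_eq k] with ω hω
    rw [← hω]
    rfl

theorem IsScenarios.above_mixLoss (hS : IsScenarios P S) (hV : Measurable V) (j : Fin s) {a b : ℝ}
    {x y : Fin s → ℝ} (hyx : y ≤ x) :
    (∀ r ∈ Set.Ioo (0 : ℝ) (1 / 2), (hS.mixLoss hV j a b x y 0).above r =
      hS.mixEvent V j a b x (coin 0)) ∧
    ∀ r ∈ Set.Ioo (1 / 2 : ℝ) 1, (hS.mixLoss hV j a b x y 0).above r =
      hS.mixEvent V j a b y (coin 0) := by
  constructor
  all_goals
    intro r hr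
    obtain ⟨h0, h1⟩ := hr
    ext ω
    rw [Loss.mem_above, hS.mixLoss_apply]
    simp only [mixValue, IsScenarios.mixEvent, coin, Set.mem_ofPred_eq]
    have := hyx (hS.index ω)
    split_ifs <;> grind

/-- In scenario `j` the average of two 0-1 losses exceeds a level below 1/2 if one of them defaults
and a level above 1/2 only if both do. In the other scenarios all losses coincide and pooling
changes nothing. -/
theorem IsScenarios.above_pool_mixLoss (hS : IsScenarios P S) (hV : Measurable V) (j : Fin s)
    {a b : ℝ} {x y : Fin s → ℝ} (hyx : y ≤ x) :
    (∀ r ∈ Set.Ioo (0 : ℝ) (1 / 2), (Loss.pool (hS.mixLoss hV j a b x y) 2).above r =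
      hS.mixEvent V j a b x (coin 0 ∪ coin 1)) ∧
    ∀ r ∈ Set.Ioo (1 / 2 : ℝ) 1, (Loss.pool (hS.mixLoss hV j a b x y) 2).above r =
      hS.mixEvent V j a b y (coin 0 ∩ coin 1) := by
  constructor
  all_goals
    intro r hr
    obtain ⟨h0, h1⟩ := hr
    ext ω
    rw [Loss.mem_above, Loss.pool_two_apply, hS.mixLoss_apply, hS.mixLoss_apply]
    simp only [mixValue, IsScenarios.mixEvent, coin, Set.mem_ofPred_eq, Set.mem_union,
      Set.mem_inter_iff]
    have := hyx (hS.index ω)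
    split_ifs <;> grind

/-- With `a = t - 2 * d` and `b = t + 2 * d`, the coin probabilities 1/2, 3/4, 1/4 give `t`, `t +
d`, `t - d` in coordinate `j`. This is the origin of the room `2 * d` in `LocallyDecreasing`. -/
theorem SPoolingEffect.locallyDecreasing_lower (hI : SPoolingEffect P S I) [IsProbabilityMeasure P]
    (hS : IsScenarios P S) (hρ : IsChoquetRepresentation I ρ) (hLI : SLawInvariant P S I)
    (hν : IsCapacity ν) (hρν : ∀ X, ρ X = choquet ν X) (hV : Measurable V)
    (hVP : ∀ j, (cond P (S j)).map V = (volume : Measure unitInterval).prod uniformSeq) :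
    LocallyDecreasing fun x => ν (hS.lower (fun ω => (V ω).1) x) := by
  intro x hx y hy hyx j t d hd h0 h1
  have hU := isUniform_fst hV hVP
  have hev : ∀ z ∈ Set.Icc (0 : Fin s → ℝ) 1, ∀ (H : Set (ℕ → unitInterval)) (r : ℝ),
      MeasurableSet H → t - 2 * d + 4 * d * uniformSeq.real H = r → 0 ≤ r → r ≤ 1 →
      ν (hS.mixEvent V j (t - 2 * d) (t + 2 * d) z H) =
        ν (hS.lower (fun ω => (V ω).1) (Function.update z j r)) := by
    intro z hz H r hH hr hr0 hr1
    refine hρ.capacity_eq hS hLI hν hρν (hS.measurableSet_mixEvent hV j _ _ z hH)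
      (hS.measurableSet_lower hU _) ?_
    rw [hS.scenarioProb_mixEvent hV hVP j h0 (by linarith) h1 hz hH,
      hS.scenarioProb_lower hU (update_mem_box hz j ⟨hr0, hr1⟩), ← hr]
    congr 1; ring
  have h := hI.rho_pool_two_le hS hρ hV hVP j (t - 2 * d) (t + 2 * d) x y
  rw [hρν, hρν, hν.choquet_two_step _ (hS.above_mixLoss hV j hyx).1 (hS.above_mixLoss hV j hyx).2,
    hν.choquet_two_step _ (hS.above_pool_mixLoss hV j hyx).1 (hS.above_pool_mixLoss hV j hyx).2,
    hev x hx (coin 0) t (measurableSet_coin 0) (by rw [uniformSeq_real_coin]; ring)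
      (by linarith) (by linarith),
    hev y hy (coin 0) t (measurableSet_coin 0) (by rw [uniformSeq_real_coin]; ring)
      (by linarith) (by linarith),
    hev x hx (coin 0 ∪ coin 1) (t + d) ((measurableSet_coin 0).union (measurableSet_coin 1))
      (by rw [uniformSeq_real_union]; ring) (by linarith) (by linarith),
    hev y hy (coin 0 ∩ coin 1) (t - d) ((measurableSet_coin 0).inter (measurableSet_coin 1))
      (by rw [uniformSeq_real_inter]; ring) (by linarith) (by linarith)] at h
  linarith

end PoolingEffect

/-! ### Pools decrease in the increasing convex order. -/

section Exchangeability

variable {Ω : Type*} [MeasurableSpace Ω] {Q : Measure Ω} [IsProbabilityMeasure Q]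

/-- Exchangeability: the probability of a box is the mean of a product of conditional probabilities
of `L 0`, in which the choice of indices no longer appears. Boxes form a generating π-system. -/
theorem IsCondIID.map_comp_eq {L : ℕ → Loss Ω} (hL : IsCondIID Q L) {l : ℕ} {e e' : Fin l → ℕ}
    (he : Function.Injective e) (he' : Function.Injective e') :
    Q.map (fun ω m => L (e m) ω) = Q.map (fun ω m => L (e' m) ω) := by
  obtain ⟨d, Z, hZ, hind, hid⟩ := hL
  have hm := hZ.comap_le
  have key : ∀ (e : Fin l → ℕ), Function.Injective e → ∀ B : Fin l → Set ℝ,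
      (∀ m, MeasurableSet (B m)) → Q.real (⋂ m, (L (e m) : Ω → ℝ) ⁻¹' B m) =
        ∫ ω, ∏ m, (Q⟦(L 0 : Ω → ℝ) ⁻¹' B m | MeasurableSpace.comap Z inferInstance⟧) ω ∂Q := by
    intro e he B hB
    have hA : MeasurableSet (⋂ m, (L (e m) : Ω → ℝ) ⁻¹' B m) :=
      MeasurableSet.iInter fun m => (L (e m)).measurable (hB m)
    let B' : ℕ → Set ℝ := Function.extend e B fun _ => Set.univ
    have hB'e : ∀ m, B' (e m) = B m := fun m => he.extend_apply _ _ _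
    have hB' : ∀ i, MeasurableSet (B' i) := by
      intro i
      by_cases hi : ∃ m, e m = i
      · obtain ⟨m, rfl⟩ := hi
        rw [hB'e]; exact hB m
      · simp only [B', Function.extend_apply' _ _ _ hi, MeasurableSet.univ]
    have hset : (⋂ i ∈ Finset.univ.map ⟨e, he⟩, (L i : Ω → ℝ) ⁻¹' B' i) =
        ⋂ m, (L (e m) : Ω → ℝ) ⁻¹' B m := by
      ext ω; simp [hB'e]
    have h1 := hind (Finset.univ.map ⟨e, he⟩) B' hB'
    rw [hset, Finset.prod_map] at h1
    have h2 : ∀ᵐ ω ∂Q, ∀ m, (Q⟦(L (e m) : Ω → ℝ) ⁻¹' B m | MeasurableSpace.comap Z inferInstance⟧) ω =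
        (Q⟦(L 0 : Ω → ℝ) ⁻¹' B m | MeasurableSpace.comap Z inferInstance⟧) ω :=
      ae_all_iff.2 fun m => hid (e m) 0 (B m) (hB m)
    rw [← integral_condExp_indicator hZ hA]
    refine integral_congr_ae ?_
    filter_upwards [h1, h2] with ω h1 h2
    rw [h1, Finset.prod_apply]
    refine Finset.prod_congr rfl fun m _ => ?_
    rw [← h2 m]
    simp only [Function.Embedding.coeFn_mk, hB'e]
  have hmeas : ∀ e : Fin l → ℕ, Measurable fun ω m => L (e m) ω := fun e =>
    measurable_pi_lambda _ fun m => (L (e m)).measurable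
  have hp : ∀ e : Fin l → ℕ, IsProbabilityMeasure (Q.map fun ω m => L (e m) ω) := fun e =>
    Measure.isProbabilityMeasure_map (hmeas e).aemeasurable
  have := hp e
  have := hp e'
  refine ext_of_generate_finite _ generateFrom_pi.symm isPiSystem_pi ?_ (by simp)
  rintro _ ⟨B, hB, rfl⟩
  have hB' : ∀ m, MeasurableSet (B m) := fun m => hB m (Set.mem_univ m)
  have hpre : ∀ e : Fin l → ℕ, (fun ω m => L (e m) ω) ⁻¹' (Set.pi Set.univ B) =
      ⋂ m, (L (e m) : Ω → ℝ) ⁻¹' B m := by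
    intro e; ext ω; simp
  rw [Measure.map_apply (hmeas e) (MeasurableSet.univ_pi hB'),
    Measure.map_apply (hmeas e') (MeasurableSet.univ_pi hB'), hpre, hpre]
  have h := (key e he B hB').trans (key e' he' B hB').symm
  exact (ENNReal.toReal_eq_toReal_iff' (measure_ne_top _ _) (measure_ne_top _ _)).1 h

theorem Loss.integrable_comp_monotone (X : Loss Ω) {φ : ℝ → ℝ} (hφ : Monotone φ) :
    Integrable (fun ω => φ (X ω)) Q :=
  Integrable.of_bound (hφ.measurable.comp X.measurable).aestronglyMeasurable (|φ 0| + |φ 1|)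
    (Filter.Eventually.of_forall fun ω => by
      have h0 := hφ (X.nonneg ω)
      have h1 := hφ (X.le_one ω)
      rw [Real.norm_eq_abs, abs_le]
      constructor <;> linarith [neg_abs_le (φ 0), le_abs_self (φ 1), abs_nonneg (φ 0), abs_nonneg (φ 1)])

/-- The pool of size `l + 1` is the average of its leave-one-out pools `Y i`. Jensen's inequality
bounds `φ` pointwise, and by exchangeability each `Y i` has the law of the pool of size `l`. -/
theorem IsCondIID.icxLE_pool_succ {L : ℕ → Loss Ω} (hL : IsCondIID Q L) {l : ℕ} (hl : 1 ≤ l) :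
    IcxLE Q (Loss.pool L (l + 1)) (Loss.pool L l) := by
  intro φ hφ hφc
  have hl0 : (0 : ℝ) < l := by exact_mod_cast hl
  let Y : Fin (l + 1) → Ω → ℝ := fun i ω => (∑ m, L (i.succAbove m) ω) / l
  have hpoint : ∀ ω, φ (Loss.pool L (l + 1) ω) ≤ ∑ i, (1 / ((l : ℝ) + 1)) * φ (Y i ω) := by
    intro ω
    have h := hφc.map_sum_le (t := Finset.univ) (w := fun _ : Fin (l + 1) => 1 / ((l : ℝ) + 1))
      (p := fun i => Y i ω) (fun _ _ => by positivity) (by simp; field_simp) fun _ _ => Set.mem_univ _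
    simp only [smul_eq_mul] at h
    refine le_of_eq_of_le (congrArg φ ?_) h
    change (∑ i ∈ Finset.range (l + 1), L i ω) / ((l + 1 : ℕ) : ℝ) = _
    rw [← Fin.sum_univ_eq_sum_range (fun i => L i ω), ← Finset.mul_sum]
    have hY : ∀ i, Y i ω = ((∑ k : Fin (l + 1), L k ω) - L i ω) / l := by
      intro i
      simp only [Y]
      rw [Fin.sum_univ_succAbove (fun k : Fin (l + 1) => L k ω) i]
      ring
    simp_rw [hY]
    rw [← Finset.sum_div, Finset.sum_sub_distrib, Finset.sum_const, Finset.card_univ,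
      Fintype.card_fin, nsmul_eq_mul]
    push_cast
    field_simp
    ring
  have hmeas : ∀ e : Fin l → ℕ, Measurable fun ω m => L (e m) ω := fun e =>
    measurable_pi_lambda _ fun m => (L (e m)).measurable
  have hφm : Measurable fun v : Fin l → ℝ => φ ((∑ m, v m) / l) :=
    hφ.measurable.comp (by fun_prop)
  have hpool : ∀ ω, Loss.pool L l ω = (∑ m : Fin l, L m ω) / l := by
    intro ω
    rw [Fin.sum_univ_eq_sum_range (fun i => L i ω)]
    rfl
  have hYint : ∀ i, ∫ ω, φ (Y i ω) ∂Q = ∫ ω, φ (Loss.pool L l ω) ∂Q := by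
    intro i
    have e1 := integral_map (μ := Q) (hmeas fun m => (i.succAbove m : ℕ)).aemeasurable
      hφm.aestronglyMeasurable
    have e2 := integral_map (μ := Q) (hmeas fun m => (m : ℕ)).aemeasurable
      hφm.aestronglyMeasurable
    rw [hL.map_comp_eq (e := fun m => (i.succAbove m : ℕ)) (e' := fun m => (m : ℕ))
      (Fin.val_injective.comp Fin.succAbove_right_injective) Fin.val_injective, e2] at e1
    simp_rw [hpool]
    exact e1.symm
  have hYi : ∀ i, Integrable (fun ω => φ (Y i ω)) Q := by
    intro i
    -- Presents `Y i` as a pool, hence a loss, for which integrability is known; entries from `l` on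
    -- play no role.
    let L' : ℕ → Loss Ω := fun k => if h : k < l then L (i.succAbove ⟨k, h⟩) else L 0
    have : ∀ ω, Y i ω = Loss.pool L' l ω := by
      intro ω
      change _ = (∑ k ∈ Finset.range l, L' k ω) / (l : ℝ)
      rw [← Fin.sum_univ_eq_sum_range (fun k => L' k ω)]
      simp [Y, L']
    simp_rw [this]
    exact (Loss.pool L' l).integrable_comp_monotone hφ
  calc ∫ ω, φ (Loss.pool L (l + 1) ω) ∂Q
      ≤ ∫ ω, ∑ i, (1 / ((l : ℝ) + 1)) * φ (Y i ω) ∂Q :=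
        integral_mono ((Loss.pool L (l + 1)).integrable_comp_monotone hφ)
          (integrable_finsetSum _ fun i _ => (hYi i).const_mul _) hpoint
    _ = ∑ i : Fin (l + 1), (1 / ((l : ℝ) + 1)) * ∫ ω, φ (Loss.pool L l ω) ∂Q := by
        rw [integral_finsetSum _ fun i _ => (hYi i).const_mul _]
        refine Finset.sum_congr rfl fun i _ => ?_
        rw [integral_const_mul, hYint]
    _ = ∫ ω, φ (Loss.pool L l ω) ∂Q := by
        rw [Finset.sum_const, Finset.card_univ, Fintype.card_fin, nsmul_eq_mul]
        push_cast
        field_simp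

theorem IsCondIID.icxLE_pool {L : ℕ → Loss Ω} (hL : IsCondIID Q L) {l l' : ℕ} (hl : 1 ≤ l)
    (hll : l ≤ l') : IcxLE Q (Loss.pool L l') (Loss.pool L l) := by
  induction l', hll using Nat.le_induction with
  | base => exact fun φ _ _ => le_rfl
  | succ k hk ih =>
    exact fun φ h1 h2 => (hL.icxLE_pool_succ (hl.trans hk) φ h1 h2).trans (ih φ h1 h2)

omit [IsProbabilityMeasure Q] in
theorem IcxLE.tranche {X Y : Loss Ω} (h : IcxLE Q X Y) {K : ℝ} (hK : K ∈ Set.Ico (0 : ℝ) 1) :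
    IcxLE Q (Loss.tranche K hK X) (Loss.tranche K hK Y) := by
  intro φ hφ hφc
  have hK1 : 0 < 1 - K := by linarith [hK.2]
  have hmono : Monotone fun x : ℝ => max (x - K) 0 / (1 - K) := fun x y hxy =>
    div_le_div_of_nonneg_right (max_le_max (by linarith) le_rfl) hK1.le
  have hconv : ConvexOn ℝ Set.univ fun x : ℝ => max (x - K) 0 / (1 - K) := by
    have h1 : ConvexOn ℝ Set.univ fun x : ℝ => x - K :=
      (convexOn_id convex_univ).sub (concaveOn_const K convex_univ)
    have h2 := (h1.sup (convexOn_const (0 : ℝ) convex_univ)).smul (inv_nonneg.2 hK1.le)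
    refine h2.congr fun x _ => ?_
    change (1 - K)⁻¹ • max (x - K) 0 = max (x - K) 0 / (1 - K)
    rw [smul_eq_mul, div_eq_inv_mul]
  refine h (fun x => φ (max (x - K) 0 / (1 - K))) (hφ.comp hmono) ⟨convex_univ, ?_⟩
  intro x _ y _ a b ha hb hab
  exact (hφ (hconv.2 (Set.mem_univ x) (Set.mem_univ y) ha hb hab)).trans
    (hφc.2 (Set.mem_univ _) (Set.mem_univ _) ha hb hab)

end Exchangeability

theorem SRiskAverse.sPoolingEffect {Ω : Type*} [MeasurableSpace Ω] {P : Measure Ω}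
    [IsProbabilityMeasure P] {s : ℕ} {S : Fin s → Set Ω} {n : ℕ} {I : RatingCriterion Ω n}
    (hS : IsScenarios P S) (hI : SRiskAverse P S I) : SPoolingEffect P S I := by
  have := hS.isProbabilityMeasure_cond
  intro L hL l l' hl hll K hK
  exact hI _ _ fun j => ((hL j).icxLE_pool hl hll).tranche hK

/-! ### Convexity of Choquet integrals for submodular capacities. -/

section Subadditivity

variable {Ω : Type*} [MeasurableSpace Ω] {ν : Set Ω → ℝ}

/-- The set `Z'.above x` is the union of `Z.above x` and `A ∩ Z.above (x - c)`, which meet in `A ∩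
Z.above x`. After submodularity the error is `m (x - c) - m x`; its integral telescopes to at most
the integral of `m` over `[-c, 0]`, where `m ≤ ν A`. -/
theorem IsCapacity.choquet_add_ind_le (hν : IsCapacity ν)
    (hsub : ∀ A B : Set Ω, MeasurableSet A → MeasurableSet B → ν (A ∪ B) + ν (A ∩ B) ≤ ν A + ν B)
    {Z Z' : Loss Ω} {c : ℝ} (hc : 0 ≤ c) {A : Set Ω} (hA : MeasurableSet A)
    (hZ : ∀ ω, Z' ω = Z ω + c * A.indicator 1 ω) :
    choquet ν Z'.toBdd ≤ choquet ν Z.toBdd + c * ν A := by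
  let m : ℝ → ℝ := fun x => ν (A ∩ Z.above x)
  have hm : Antitone m := fun x y hxy => hν.mono _ _ (hA.inter (Z.measurableSet_above _))
    (hA.inter (Z.measurableSet_above _)) (Set.inter_subset_inter_right _ (Z.above_anti hxy))
  have hmi : ∀ a b, IntervalIntegrable m volume a b := fun a b => hm.intervalIntegrable
  have hm' : Antitone fun x => m (x - c) := fun x y hxy => hm (by linarith)
  have hmi' : IntervalIntegrable (fun x => m (x - c)) volume 0 1 := hm'.intervalIntegrable
  have hpoint : ∀ x, ν (Z'.above x) ≤ ν (Z.above x) + (m (x - c) - m x) := by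
    intro x
    have h := hsub (Z.above x) (A ∩ Z.above (x - c)) (Z.measurableSet_above _)
      (hA.inter (Z.measurableSet_above _))
    have e1 : Z.above x ∪ A ∩ Z.above (x - c) = Z'.above x := by
      ext ω
      simp only [Set.mem_union, Set.mem_inter_iff, Loss.mem_above, hZ]
      by_cases hω : ω ∈ A
      · simp only [hω, true_and, Set.indicator_of_mem, Pi.one_apply, mul_one]
        constructor
        · rintro (h | h) <;> linarith
        · intro h; right; linarith
      · simp [hω]
    have e2 : Z.above x ∩ (A ∩ Z.above (x - c)) = A ∩ Z.above x := by
      ext ω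
      simp only [Set.mem_inter_iff, Loss.mem_above]
      constructor
      · rintro ⟨h1, h2, -⟩; exact ⟨h2, h1⟩
      · rintro ⟨h1, h2⟩; exact ⟨h2, h1, by linarith⟩
    rw [e1, e2] at h
    simp only [m]
    linarith
  have hint : ∫ x in (0 : ℝ)..1, (m (x - c) - m x) ≤ c * ν A := by
    rw [intervalIntegral.integral_sub hmi' (hmi 0 1),
      intervalIntegral.integral_comp_sub_right m c, zero_sub]
    have e1 := intervalIntegral.integral_add_adjacent_intervals (hmi (-c) 0) (hmi 0 (1 - c))
    have e2 := intervalIntegral.integral_add_adjacent_intervals (hmi 0 (1 - c)) (hmi (1 - c) 1)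
    have h1 : ∫ x in (-c)..0, m x ≤ ∫ x in (-c)..0, ν A :=
      intervalIntegral.integral_mono_on (by linarith) (hmi _ _) intervalIntegrable_const
        fun x _ => hν.mono _ _ (hA.inter (Z.measurableSet_above _)) hA Set.inter_subset_left
    have h2 : 0 ≤ ∫ x in (1 - c)..1, m x :=
      intervalIntegral.integral_nonneg (by linarith) fun x _ =>
        hν.nonneg (hA.inter (Z.measurableSet_above _))
    rw [intervalIntegral.integral_const, smul_eq_mul] at h1
    linarith
  rw [hν.choquet_toBdd Z' le_rfl, hν.choquet_toBdd Z le_rfl]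
  calc ∫ x in (0 : ℝ)..1, ν (Z'.above x)
      ≤ ∫ x in (0 : ℝ)..1, (ν (Z.above x) + (m (x - c) - m x)) :=
        intervalIntegral.integral_mono_on zero_le_one (hν.intervalIntegrable Z' _ _)
          ((hν.intervalIntegrable Z _ _).add (hmi'.sub (hmi 0 1))) fun x _ => hpoint x
    _ ≤ _ := by
        rw [intervalIntegral.integral_add (hν.intervalIntegrable Z _ _) (hmi'.sub (hmi 0 1))]
        linarith

/-- For a decreasing integrand the right-endpoint sum is below the integral; the left-endpoint sum
differs by the two end terms, at most 1. -/
theorem IsCapacity.riemann_sum_le (hν : IsCapacity ν) (Y : Loss Ω) {N : ℕ} (hN : 0 < N) :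
    ∑ i ∈ Finset.range N, ν (Y.above (i / N)) ≤ N * choquet ν Y.toBdd + 1 := by
  have hN0 : (0 : ℝ) < N := by exact_mod_cast hN
  have hanti : Antitone fun x : ℝ => ν (Y.above (x / N)) := fun x y hxy =>
    hν.antitone Y (div_le_div_of_nonneg_right hxy hN0.le)
  have h := (hanti.antitoneOn (Set.Icc (0 : ℝ) (0 + (N : ℕ)))).sum_le_integral
  simp only [zero_add] at h
  rw [intervalIntegral.integral_comp_div (fun x => ν (Y.above x)) hN0.ne', zero_div,
    div_self hN0.ne', ← hν.choquet_toBdd Y le_rfl, smul_eq_mul] at h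
  have hs := Finset.sum_range_succ' (fun i : ℕ => ν (Y.above (i / N))) N
  rw [Finset.sum_range_succ] at hs
  have h0 := hν.le_one (Y.measurableSet_above (((0 : ℕ) : ℝ) / N))
  have h1 := hν.nonneg (Y.measurableSet_above ((N : ℝ) / N))
  linarith

/-- Choquet integrals with respect to submodular capacities are convex. -/
theorem IsCapacity.choquet_mix_le (hν : IsCapacity ν)
    (hsub : ∀ A B : Set Ω, MeasurableSet A → MeasurableSet B → ν (A ∪ B) + ν (A ∩ B) ≤ ν A + ν B)
    {t : ℝ} (ht0 : 0 < t) (ht : t ∈ Set.Icc (0 : ℝ) 1) (X Y : Loss Ω) :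
    choquet ν (Loss.mix t ht X Y).toBdd ≤ t * choquet ν X.toBdd + (1 - t) * choquet ν Y.toBdd := by
  have ht1 : 0 ≤ 1 - t := by linarith [ht.2]
  have hN : ∀ N : ℕ, 0 < N → choquet ν (Loss.mix t ht X Y).toBdd ≤
      t * choquet ν X.toBdd + (1 - t) * choquet ν Y.toBdd + (1 - t) / N := by
    intro N hN
    have hN0 : (0 : ℝ) < N := by exact_mod_cast hN
    have hc0 : 0 ≤ (1 - t) / N := div_nonneg ht1 hN0.le
    let A : ℕ → Set Ω := fun i => Y.above (i / N)
    have hA : ∀ i, MeasurableSet (A i) := fun i => Y.measurableSet_above _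
    have hind : ∀ i ω, 0 ≤ (A i).indicator (1 : Ω → ℝ) ω ∧ (A i).indicator (1 : Ω → ℝ) ω ≤ 1 :=
      fun i ω => (Loss.ind (A i) (hA i)).2.2 ω
    -- `Y` is replaced by the staircase of its superlevel sets at `i / N`, added to `t * X` one
    -- indicator at a time; the total weight `t + (1 - t)` keeps each partial sum in `[0,1]`.
    have main : ∀ k ≤ N, ∃ Z : Loss Ω,
        (∀ ω, Z ω = t * X ω + (1 - t) / N * ∑ i ∈ Finset.range k, (A i).indicator 1 ω) ∧
        choquet ν Z.toBdd ≤ t * choquet ν X.toBdd + (1 - t) / N * ∑ i ∈ Finset.range k, ν (A i) := by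
      intro k
      induction k with
      | zero =>
        intro _
        refine ⟨X.affine t 0 ht.1 le_rfl (by linarith [ht.2]), fun ω => ?_, ?_⟩
        · change t * X ω + 0 = _; simp
        · rw [hν.choquet_affine ht0]; simp
      | succ k ih =>
        intro hk
        obtain ⟨Z, hZ, hZle⟩ := ih (by omega)
        have hm : Measurable fun ω => Z ω + (1 - t) / N * (A k).indicator 1 ω :=
          Z.measurable.add ((measurable_const.indicator (hA k)).const_mul _)
        have hle : ∀ ω, Z ω + (1 - t) / N * (A k).indicator 1 ω ≤ 1 := by
          intro ω
          rw [hZ ω, add_assoc, ← mul_add, ← Finset.sum_range_succ (fun i => (A i).indicator 1 ω)]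
          have h1 : ∑ i ∈ Finset.range (k + 1), (A i).indicator (1 : Ω → ℝ) ω ≤ N := by
            calc ∑ i ∈ Finset.range (k + 1), (A i).indicator (1 : Ω → ℝ) ω
                ≤ ∑ i ∈ Finset.range (k + 1), (1 : ℝ) :=
                  Finset.sum_le_sum fun i _ => (hind i ω).2
              _ = ((k + 1 : ℕ) : ℝ) := by simp
              _ ≤ N := by exact_mod_cast hk
          have h2 := mul_le_mul_of_nonneg_left h1 hc0
          rw [div_mul_cancel₀ _ hN0.ne'] at h2
          nlinarith [X.le_one ω]
        let Z' : Loss Ω := ⟨fun ω => Z ω + (1 - t) / N * (A k).indicator 1 ω, hm, fun ω =>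
          ⟨add_nonneg (Z.nonneg ω) (mul_nonneg hc0 (hind k ω).1), hle ω⟩⟩
        refine ⟨Z', fun ω => ?_, ?_⟩
        · change Z ω + (1 - t) / N * (A k).indicator 1 ω = _
          rw [hZ ω, Finset.sum_range_succ]; ring
        · have := hν.choquet_add_ind_le hsub (Z := Z) (Z' := Z') hc0 (hA k) fun ω => rfl
          rw [Finset.sum_range_succ, mul_add]
          linarith
    obtain ⟨Z, hZ, hZle⟩ := main N le_rfl
    have hmono : choquet ν (Loss.mix t ht X Y).toBdd ≤ choquet ν Z.toBdd := by
      refine hν.choquet_mono fun ω => ?_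
      rw [hZ]
      change t * X ω + (1 - t) * Y ω ≤ _
      have hsum : (N : ℝ) * Y ω ≤ ∑ i ∈ Finset.range N, (A i).indicator (1 : Ω → ℝ) ω := by
        -- The levels include `i = 0` and the inequality `i / N < Y ω` is strict, so the count is a
        -- ceiling and the staircase dominates `Y`.
        have hcard : ∑ i ∈ Finset.range N, (A i).indicator (1 : Ω → ℝ) ω = (⌈(N : ℝ) * Y ω⌉₊ : ℝ) := by
          have hle : ⌈(N : ℝ) * Y ω⌉₊ ≤ N := by
            rw [Nat.ceil_le]; nlinarith [Y.le_one ω]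
          have : ∀ i : ℕ, (A i).indicator (1 : Ω → ℝ) ω =
              if i ∈ Finset.range ⌈(N : ℝ) * Y ω⌉₊ then 1 else 0 := by
            intro i
            have hiff : ω ∈ A i ↔ i ∈ Finset.range ⌈(N : ℝ) * Y ω⌉₊ := by
              rw [Finset.mem_range, Nat.lt_ceil, Loss.mem_above, div_lt_iff₀ hN0, mul_comm]
            by_cases h : ω ∈ A i
            · rw [if_pos (hiff.1 h), Set.indicator_of_mem h, Pi.one_apply]
            · rw [if_neg (mt hiff.2 h), Set.indicator_of_notMem h]
          simp_rw [this]
          rw [Finset.sum_ite_mem, Finset.inter_eq_right.2 (Finset.range_mono hle)]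
          simp
        rw [hcard]
        exact Nat.le_ceil _
      have h2 := mul_le_mul_of_nonneg_left hsum hc0
      have e : (1 - t) / N * (N * Y ω) = (1 - t) * Y ω := by field_simp
      rw [e] at h2
      linarith
    have hR := mul_le_mul_of_nonneg_left (hν.riemann_sum_le Y hN) hc0
    have e : (1 - t) / N * (N * choquet ν Y.toBdd + 1) =
        (1 - t) * choquet ν Y.toBdd + (1 - t) / N := by field_simp
    rw [e] at hR
    exact hmono.trans (hZle.trans (by linarith))
  have hlim : Filter.Tendsto (fun N : ℕ => t * choquet ν X.toBdd + (1 - t) * choquet ν Y.toBdd +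
      (1 - t) / N) Filter.atTop
      (nhds (t * choquet ν X.toBdd + (1 - t) * choquet ν Y.toBdd + 0)) :=
    (tendsto_const_div_atTop_nhds_zero_nat (1 - t)).const_add _
  rw [add_zero] at hlim
  exact ge_of_tendsto hlim (Filter.eventually_atTop.2 ⟨1, fun N h => hN N h⟩)

end Subadditivity

/-! ### From the distortion function to quasi-convexity. -/

section Convexity

variable {Ω : Type*} [MeasurableSpace Ω] {P : Measure Ω} {s : ℕ} {S : Fin s → Set Ω} {n : ℕ}
  {I : RatingCriterion Ω n} {ρ : BddRV Ω → ℝ}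

/-- The probabilities of `A ∩ B` are in general not the minima of those of `A` and `B`, so lattice
submodularity of `g` is not enough; decreasing increments, which also encode concavity, are. -/
theorem DecreasingIncrements.submodular_scenarioProb [IsProbabilityMeasure P]
    (hS : IsScenarios P S) {g : (Fin s → ℝ) → ℝ} (hg : DecreasingIncrements g) {A B : Set Ω}
    (hB : MeasurableSet B) :
    g (scenarioProb P S (A ∪ B)) + g (scenarioProb P S (A ∩ B)) ≤
      g (scenarioProb P S A) + g (scenarioProb P S B) := by
  have hprob := hS.isProbabilityMeasure_cond
  have e : scenarioProb P S B + (scenarioProb P S A - scenarioProb P S (A ∩ B)) =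
      scenarioProb P S (A ∪ B) := by
    ext j
    have := measureReal_union_add_inter (μ := cond P (S j)) (s := A) hB
    simp only [scenarioProb, Pi.add_apply, Pi.sub_apply]
    linarith
  have h := hg (scenarioProb P S B) (scenarioProb P S (A ∩ B))
    (scenarioProb P S A - scenarioProb P S (A ∩ B)) (scenarioProb_mem_Icc hS _).1
    (scenarioProb_mono hS Set.inter_subset_right)
    (sub_nonneg.2 (scenarioProb_mono hS Set.inter_subset_left))
    (by rw [e]; exact (scenarioProb_mem_Icc hS _).2)
  rw [e, add_sub_cancel] at h
  linarith

theorem IsSDistortionFunction.quasiConvex [IsProbabilityMeasure P] (hS : IsScenarios P S)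
    (hρ : IsChoquetRepresentation I ρ) {g : (Fin s → ℝ) → ℝ} (hg : IsSDistortionFunction P S ρ g)
    (hinc : DecreasingIncrements g) : QuasiConvex I := by
  intro X Y t ht
  rcases ht.1.eq_or_lt with h0 | h0
  · have : Loss.mix t ht X Y = Y := Loss.ext fun ω => by
      change t * X ω + (1 - t) * Y ω = Y ω
      rw [← h0]; ring
    rw [this]; exact le_max_right _ _
  have h := (hg.isCapacity hS).choquet_mix_le
    (fun A B _ hB => hinc.submodular_scenarioProb hS hB) h0 ht X Y
  rw [← hg.repr, ← hg.repr, ← hg.repr] at h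
  have ht1 : 0 ≤ 1 - t := by linarith [ht.2]
  rcases le_total (ρ X.toBdd) (ρ Y.toBdd) with hXY | hXY
  · exact (hρ.rate_le_of_rho_le (by nlinarith)).trans (le_max_right _ _)
  · exact (hρ.rate_le_of_rho_le (by nlinarith)).trans (le_max_left _ _)

end Convexity

/-! ### Tail integrals against increasing weights. -/

section Weights

/-- Integration against an increasing nonnegative weight preserves dominance of tail integrals. -/
theorem integral_monotone_mul_nonneg {w D : ℝ → ℝ} (hw : Monotone w) (hw0 : ∀ t, 0 ≤ w t)
    (hD : Measurable D) {C : ℝ} (hDC : ∀ t, |D t| ≤ C)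
    (h : ∀ t ∈ Set.Icc (0 : ℝ) 1, 0 ≤ ∫ u in t..1, D u) : 0 ≤ ∫ t in (0 : ℝ)..1, w t * D t := by
  have hC : 0 ≤ C := (abs_nonneg _).trans (hDC 0)
  rw [intervalIntegral.integral_of_le zero_le_one]
  -- Layer-cake representation of `w`. After Fubini, each layer `{t | r < w t}` is, up to its left
  -- endpoint `c`, the interval `(c, 1]`, on which the integral of `D` is nonnegative.
  let f : ℝ → ℝ → ℝ := fun t r => (Set.Iio (w t)).indicator (fun _ => D t) r
  have hf : ∀ t ∈ Set.Ioc (0 : ℝ) 1, w t * D t = ∫ r in Set.Ioc 0 (w 1), f t r := by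
    intro t ht
    have hle : w t ≤ w 1 := hw ht.2
    have e : ∫ r in Set.Ioc 0 (w 1), f t r = ∫ r in Set.Ioc 0 (w 1) ∩ Set.Iio (w t), D t :=
      setIntegral_indicator measurableSet_Iio
    have e2 : Set.Ioc 0 (w 1) ∩ Set.Iio (w t) = Set.Ioo 0 (w t) := by
      ext r
      constructor
      · rintro ⟨⟨a, -⟩, b⟩; exact ⟨a, b⟩
      · rintro ⟨a, b⟩; exact ⟨⟨a, (le_of_lt b).trans hle⟩, b⟩
    rw [e, e2, setIntegral_const, Measure.real, Real.volume_Ioo, sub_zero,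
      ENNReal.toReal_ofReal (hw0 t), smul_eq_mul]
  rw [setIntegral_congr_fun measurableSet_Ioc hf]
  have hfm : Measurable (Function.uncurry f) := by
    have : Function.uncurry f = {p : ℝ × ℝ | p.2 < w p.1}.indicator fun p => D p.1 := by
      funext p
      rfl
    rw [this]
    exact (hD.comp measurable_fst).indicator
      (measurableSet_lt measurable_snd (hw.measurable.comp measurable_fst))
  have hint : Integrable (Function.uncurry f)
      ((volume.restrict (Set.Ioc (0 : ℝ) 1)).prod (volume.restrict (Set.Ioc 0 (w 1)))) := by
    refine Integrable.of_bound hfm.aestronglyMeasurable C (Filter.Eventually.of_forall fun p => ?_)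
    simp only [Function.uncurry, f, Set.indicator_apply]
    split_ifs
    · exact hDC _
    · simpa using hC
  rw [integral_integral_swap hint]
  refine integral_nonneg fun r => ?_
  have e : ∀ t, f t r = {t | r < w t}.indicator D t := fun t => rfl
  have hT : MeasurableSet {t | r < w t} := measurableSet_lt measurable_const hw.measurable
  simp only [e, Pi.zero_apply]
  rw [setIntegral_indicator hT]
  rcases (Set.Ioc (0 : ℝ) 1 ∩ {t | r < w t}).eq_empty_or_nonempty with h0 | ⟨t0, ht0⟩
  · rw [h0]; simp
  set c := sInf (Set.Ioc (0 : ℝ) 1 ∩ {t | r < w t}) with hc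
  have hbd : BddBelow (Set.Ioc (0 : ℝ) 1 ∩ {t | r < w t}) := ⟨0, fun t ht => ht.1.1.le⟩
  have hc0 : 0 ≤ c := le_csInf ⟨t0, ht0⟩ fun t ht => ht.1.1.le
  have hc1 : c ≤ 1 := (csInf_le hbd ht0).trans ht0.1.2
  have hsub : Set.Ioc c 1 ⊆ Set.Ioc (0 : ℝ) 1 ∩ {t | r < w t} := by
    intro t ht
    obtain ⟨u, hu, hut⟩ := exists_lt_of_csInf_lt ⟨t0, ht0⟩ ht.1
    exact ⟨⟨hc0.trans_lt ht.1, ht.2⟩, lt_of_lt_of_le hu.2 (hw hut.le)⟩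
  have hsup : Set.Ioc (0 : ℝ) 1 ∩ {t | r < w t} ⊆ Set.Icc c 1 := fun t ht =>
    ⟨csInf_le hbd ht, ht.1.2⟩
  have hae : (Set.Ioc (0 : ℝ) 1 ∩ {t | r < w t} : Set ℝ) =ᵐ[volume] Set.Ioc c 1 :=
    Filter.EventuallyLE.antisymm
      (hsup.eventuallyLE.trans Ioc_ae_eq_Icc.symm.le) hsub.eventuallyLE
  rw [setIntegral_congr_set hae, ← intervalIntegral.integral_of_le hc1]
  exact h c ⟨hc0, hc1⟩

end Weights

/-! ### Supergradients of concave functions. -/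

section Concave

/-- The infimum of the slopes of `k` over the intervals `[b - h, b]` with `0 < h ≤ ε`. -/
noncomputable def lowerSlope (k : ℝ → ℝ) (ε b : ℝ) : ℝ :=
  ⨅ h : Set.Ioc (0 : ℝ) ε, (k b - k (b - h)) / h

variable {k : ℝ → ℝ} {ε b : ℝ}

theorem bddBelow_slopes (hk : MonotoneOn k (Set.Icc 0 1)) (hb : b ∈ Set.Icc ε 1) :
    BddBelow (Set.range fun h : Set.Ioc (0 : ℝ) ε => (k b - k (b - h)) / h) := by
  refine ⟨0, ?_⟩
  rintro _ ⟨⟨h, h0, hε⟩, rfl⟩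
  exact div_nonneg (sub_nonneg.2 (hk ⟨by linarith [hb.1], by linarith [hb.2]⟩
    ⟨by linarith [hb.1], hb.2⟩ (by linarith))) h0.le

theorem lowerSlope_nonneg (hk : MonotoneOn k (Set.Icc 0 1)) (hb : b ∈ Set.Icc ε 1) :
    0 ≤ lowerSlope k ε b := by
  refine Real.iInf_nonneg ?_
  rintro ⟨h, h0, hε⟩
  exact div_nonneg (sub_nonneg.2 (hk ⟨by linarith [hb.1], by linarith [hb.2]⟩
    ⟨by linarith [hb.1], hb.2⟩ (by linarith))) h0.le

/-- For concave `k` the infimum is a left derivative, hence a supergradient: it is at most every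
slope to the left of `b` and at least every slope to the right. The condition `ε ≤ b` keeps `b - h`
in the domain. -/
theorem _root_.ConcaveOn.sub_le_lowerSlope_mul (hkc : ConcaveOn ℝ (Set.Icc 0 1) k)
    (hk : MonotoneOn k (Set.Icc 0 1)) (hε : 0 < ε) (hb : b ∈ Set.Icc ε 1) {a : ℝ}
    (ha : a ∈ Set.Icc (0 : ℝ) 1) : k a - k b ≤ lowerSlope k ε b * (a - b) := by
  have hb' : b ∈ Set.Icc (0 : ℝ) 1 := ⟨by linarith [hb.1], hb.2⟩
  rcases lt_trichotomy a b with hab | rfl | hab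
  · set h := min (b - a) ε with hh
    have h0 : 0 < h := lt_min (by linarith) hε
    have hε' : h ≤ ε := min_le_right _ _
    have hba : h ≤ b - a := min_le_left _ _
    have h1 : lowerSlope k ε b ≤ (k b - k (b - h)) / h :=
      ciInf_le (bddBelow_slopes hk hb) (⟨h, h0, hε'⟩ : Set.Ioc (0 : ℝ) ε)
    have h2 : (k b - k (b - h)) / h ≤ (k b - k a) / (b - a) := by
      rcases hba.eq_or_lt with e | hlt
      · rw [e]; simp
      · have h3 := hkc.slope_anti_adjacent ha hb' (show a < b - h by linarith)
          (show b - h < b by linarith)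
        rw [sub_sub_cancel] at h3
        have h4 : 0 < b - h - a := by linarith
        rw [div_le_div_iff₀ h0 h4] at h3
        rw [div_le_div_iff₀ h0 (by linarith)]
        nlinarith
    have h5 := h1.trans h2
    rw [le_div_iff₀ (by linarith)] at h5
    linarith
  · simp
  · have : Nonempty (Set.Ioc (0 : ℝ) ε) := ⟨⟨ε, hε, le_rfl⟩⟩
    have h1 : (k a - k b) / (a - b) ≤ lowerSlope k ε b := by
      refine le_ciInf ?_
      rintro ⟨h, h0, hhε⟩
      have h3 := hkc.slope_anti_adjacent (x := b - h) (y := b) (z := a)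
        ⟨by linarith [hb.1], by linarith [hb.2]⟩ ha (by linarith) hab
      rwa [sub_sub_cancel] at h3
    rwa [div_le_iff₀ (by linarith)] at h1

theorem lowerSlope_le_lowerSlope {l : ℝ → ℝ} {c : ℝ} (hk : MonotoneOn k (Set.Icc 0 1))
    (hε : 0 < ε) (hb : b ∈ Set.Icc ε 1)
    (h : ∀ r, 0 ≤ r → r ≤ ε → k b - k (b - r) ≤ l c - l (c - r)) :
    lowerSlope k ε b ≤ lowerSlope l ε c := by
  have : Nonempty (Set.Ioc (0 : ℝ) ε) := ⟨⟨ε, hε, le_rfl⟩⟩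
  refine ciInf_mono (bddBelow_slopes hk hb) ?_
  rintro ⟨r, hr0, hr⟩
  exact div_le_div_of_nonneg_right (h r hr0.le hr) hr0.le

end Concave

/-! ### Integrals of the distortion function along decreasing curves. -/

section Curves

variable {s : ℕ} {g : (Fin s → ℝ) → ℝ}

theorem antitone_comp_curve (hg : MonotoneOn g (Set.Icc 0 1)) {x : ℝ → Fin s → ℝ}
    (hx : Antitone x) (hx1 : ∀ t, x t ∈ Set.Icc (0 : Fin s → ℝ) 1) : Antitone fun t => g (x t) :=
  fun _ _ h => hg (hx1 _) (hx1 _) (hx h)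

/-- Concavity bounds the gain from `a t` to `b t` below by `w t * (b t - a t)`, with `w t` a
supergradient at `b t`. The weight `w` is increasing, so the ordering of tail integrals makes the
integral of this bound nonnegative. -/
theorem integral_update_le (hg : MonotoneOn g (Set.Icc 0 1)) (hgc : ComponentwiseConcave g)
    (hgd : DecreasingDifferences g) {x : ℝ → Fin s → ℝ} (hx : Antitone x)
    (hx1 : ∀ t, x t ∈ Set.Icc (0 : Fin s → ℝ) 1) (j : Fin s) {ε : ℝ} (hε : 0 < ε) {a b : ℝ → ℝ}
    (ha : Antitone a) (hb : Antitone b) (ha1 : ∀ t, a t ∈ Set.Icc ε 1)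
    (hb1 : ∀ t, b t ∈ Set.Icc ε 1)
    (hab : ∀ t ∈ Set.Icc (0 : ℝ) 1, ∫ u in t..1, a u ≤ ∫ u in t..1, b u) :
    ∫ t in (0 : ℝ)..1, g (Function.update (x t) j (a t)) ≤
      ∫ t in (0 : ℝ)..1, g (Function.update (x t) j (b t)) := by
  let k : ℝ → ℝ → ℝ := fun t u => g (Function.update (x t) j u)
  have hI : ∀ {u : ℝ}, u ∈ Set.Icc ε 1 → u ∈ Set.Icc (0 : ℝ) 1 := fun h =>
    ⟨by linarith [h.1], h.2⟩
  have hk : ∀ t, MonotoneOn (k t) (Set.Icc 0 1) := fun t u hu v hv huv =>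
    hg (update_mem_box (hx1 t) j hu) (update_mem_box (hx1 t) j hv)
      (update_le_update_iff.2 ⟨huv, fun _ _ => le_rfl⟩)
  have hkc : ∀ t, ConcaveOn ℝ (Set.Icc 0 1) (k t) := fun t => hgc _ (hx1 t) j
  let w : ℝ → ℝ := fun t => lowerSlope (k t) ε (b t)
  have hw0 : ∀ t, 0 ≤ w t := fun t => lowerSlope_nonneg (hk t) (hb1 t)
  -- As `t` grows, `x t` and `b t` decrease: the first raises left slopes by decreasing differences,
  -- the second by concavity.
  have hw : Monotone w := by
    intro t t' htt
    refine lowerSlope_le_lowerSlope (hk t) hε (hb1 t) fun r hr0 hr => ?_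
    have hbt := hb1 t
    have hbt' := hb1 t'
    have h1 := hgd _ (hx1 t) _ (hx1 t') (hx htt) j (b t - r) (b t) (by linarith [hbt.1])
      (by linarith) hbt.2
    have h2 := (hkc t').add_sub_le_add_sub (p := b t' - r) (q := b t - r) (d := r)
      ⟨by linarith [hbt'.1], by linarith [hbt'.2]⟩ (by linarith [hb htt]) hr0
      ⟨by linarith [hbt.1], by linarith [hbt.2]⟩
    rw [sub_add_cancel, sub_add_cancel] at h2
    exact h1.trans h2
  have hcurve : ∀ c : ℝ → ℝ, Antitone c → (∀ t, c t ∈ Set.Icc ε 1) →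
      Antitone fun t => g (Function.update (x t) j (c t)) := fun c hc hc1 =>
    antitone_comp_curve hg
      (fun t t' h => update_le_update_iff.2 ⟨hc h, fun i _ => hx h i⟩)
      fun t => update_mem_box (hx1 t) j (hI (hc1 t))
  have hia : IntervalIntegrable (fun t => k t (a t)) volume 0 1 :=
    (hcurve a ha ha1).intervalIntegrable
  have hib : IntervalIntegrable (fun t => k t (b t)) volume 0 1 :=
    (hcurve b hb hb1).intervalIntegrable
  have hDm : Measurable fun t => b t - a t := hb.measurable.sub ha.measurable
  have hD1 : ∀ t, |b t - a t| ≤ 1 := fun t => abs_le.2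
    ⟨by linarith [(ha1 t).2, (hb1 t).1], by linarith [(ha1 t).1, (hb1 t).2]⟩
  have hmain := integral_monotone_mul_nonneg hw hw0 hDm hD1 fun t ht => by
    rw [intervalIntegral.integral_sub hb.intervalIntegrable ha.intervalIntegrable]
    exact sub_nonneg.2 (hab t ht)
  have hwD : IntervalIntegrable (fun t => w t * (b t - a t)) volume 0 1 := by
    rw [intervalIntegrable_iff_integrableOn_Ioc_of_le zero_le_one]
    refine Integrable.of_bound (hw.measurable.mul hDm).aestronglyMeasurable (w 1) ?_
    refine (ae_restrict_iff' measurableSet_Ioc).2 (Filter.Eventually.of_forall fun t ht => ?_)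
    rw [norm_mul, Real.norm_eq_abs, Real.norm_eq_abs, abs_of_nonneg (hw0 t)]
    calc w t * |b t - a t| ≤ w t * 1 := mul_le_mul_of_nonneg_left (hD1 t) (hw0 t)
      _ ≤ w 1 := by rw [mul_one]; exact hw ht.2
  have hle : ∫ t in (0 : ℝ)..1, w t * (b t - a t) ≤ ∫ t in (0 : ℝ)..1, (k t (b t) - k t (a t)) := by
    refine intervalIntegral.integral_mono_on zero_le_one hwD (hib.sub hia) fun t _ => ?_
    have := (hkc t).sub_le_lowerSlope_mul (hk t) hε (hb1 t) (hI (ha1 t))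
    change lowerSlope (k t) ε (b t) * (b t - a t) ≤ _
    linarith
  rw [intervalIntegral.integral_sub hib hia] at hle
  change ∫ t in (0 : ℝ)..1, k t (a t) ≤ ∫ t in (0 : ℝ)..1, k t (b t)
  linarith

theorem integral_curve_le_of_pos (hg : MonotoneOn g (Set.Icc 0 1)) (hgc : ComponentwiseConcave g)
    (hgd : DecreasingDifferences g) {ε : ℝ} (hε : 0 < ε) {x y : ℝ → Fin s → ℝ} (hx : Antitone x)
    (hy : Antitone y) (hx1 : ∀ t i, x t i ∈ Set.Icc ε 1) (hy1 : ∀ t i, y t i ∈ Set.Icc ε 1)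
    (hxy : ∀ i, ∀ t ∈ Set.Icc (0 : ℝ) 1, ∫ u in t..1, x u i ≤ ∫ u in t..1, y u i) :
    ∫ t in (0 : ℝ)..1, g (x t) ≤ ∫ t in (0 : ℝ)..1, g (y t) := by
  have key : ∀ T : Finset (Fin s), ∫ t in (0 : ℝ)..1, g (x t) ≤
      ∫ t in (0 : ℝ)..1, g (T.piecewise (y t) (x t)) := by
    intro T
    induction T using Finset.induction_on with
    | empty => simp
    | insert j T hj ih =>
      refine ih.trans ?_
      have e1 : ∀ t, T.piecewise (y t) (x t) =
          Function.update (T.piecewise (y t) (x t)) j (x t j) := by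
        intro t
        rw [eq_comm, Function.update_eq_self_iff, Finset.piecewise_eq_of_notMem _ _ _ hj]
      have e2 : ∀ t, (insert j T).piecewise (y t) (x t) =
          Function.update (T.piecewise (y t) (x t)) j (y t j) := fun t =>
        Finset.piecewise_insert _ _ _ _
      have h := integral_update_le hg hgc hgd (x := fun t => T.piecewise (y t) (x t))
        (fun t t' h => fun i => by
          by_cases hi : i ∈ T
          · simpa [hi] using hy h i
          · simpa [hi] using hx h i) ?_ j hε
        (a := fun t => x t j) (b := fun t => y t j) (fun t t' h => hx h j) (fun t t' h => hy h j)
        (fun t => hx1 t j) (fun t => hy1 t j) (hxy j)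
      · simp_rw [e2]
        refine le_of_eq_of_le ?_ h
        refine intervalIntegral.integral_congr fun t _ => ?_
        exact congrArg g (e1 t)
      · intro t
        constructor
        · intro i
          by_cases hi : i ∈ T
          · simpa [hi] using hε.le.trans (hy1 t i).1
          · simpa [hi] using hε.le.trans (hx1 t i).1
        · intro i
          by_cases hi : i ∈ T
          · simpa [hi] using (hy1 t i).2
          · simpa [hi] using (hx1 t i).2
  have := key Finset.univ
  simpa only [Finset.piecewise_univ] using this

/-- The integral of a submodular and componentwise concave function along decreasing curves
increases with the tail integrals of the coordinates. -/
theorem integral_curve_le (hg : MonotoneOn g (Set.Icc 0 1)) (hgc : ComponentwiseConcave g)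
    (hgd : DecreasingDifferences g) (hgcont : Continuous g) {x y : ℝ → Fin s → ℝ} (hx : Antitone x)
    (hy : Antitone y) (hx1 : ∀ t, x t ∈ Set.Icc (0 : Fin s → ℝ) 1)
    (hy1 : ∀ t, y t ∈ Set.Icc (0 : Fin s → ℝ) 1)
    (hxy : ∀ i, ∀ t ∈ Set.Icc (0 : ℝ) 1, ∫ u in t..1, x u i ≤ ∫ u in t..1, y u i) :
    ∫ t in (0 : ℝ)..1, g (x t) ≤ ∫ t in (0 : ℝ)..1, g (y t) := by
  -- Lifts the curves off the face 0, where a supergradient could be infinite; `ε → 0` uses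
  -- continuity of `g` and dominated convergence.
  let c : ℝ → (Fin s → ℝ) → Fin s → ℝ := fun ε z i => ε + (1 - ε) * z i
  have hcbox : ∀ ε ∈ Set.Ioo (0 : ℝ) 1, ∀ z ∈ Set.Icc (0 : Fin s → ℝ) 1, ∀ i,
      c ε z i ∈ Set.Icc ε 1 := by
    intro ε hε z hz i
    have h0 : 0 ≤ z i := hz.1 i
    have h1 : z i ≤ 1 := hz.2 i
    have := hε.2
    constructor <;> simp only [c] <;> nlinarith
  have hanti : ∀ ε ∈ Set.Ioo (0 : ℝ) 1, ∀ z : ℝ → Fin s → ℝ, Antitone z →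
      Antitone fun t => c ε (z t) := fun ε hε z hz t t' h i =>
    add_le_add_right (mul_le_mul_of_nonneg_left (hz h i) (by linarith [hε.2])) ε
  have hlim : ∀ z : ℝ → Fin s → ℝ, Antitone z → (∀ t, z t ∈ Set.Icc (0 : Fin s → ℝ) 1) →
      Filter.Tendsto (fun ε => ∫ t in (0 : ℝ)..1, g (c ε (z t))) (nhdsWithin 0 (Set.Ioi 0))
        (nhds (∫ t in (0 : ℝ)..1, g (z t))) := by
    intro z hz hz1
    refine intervalIntegral.tendsto_integral_filter_of_dominated_convergence
      (fun _ => |g 0| + |g 1|) ?_ ?_ intervalIntegrable_const ?_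
    · filter_upwards [Ioo_mem_nhdsGT (zero_lt_one' ℝ)] with ε hε
      exact (antitone_comp_curve hg (hanti ε hε z hz) fun t =>
        ⟨fun i => hε.1.le.trans (hcbox ε hε _ (hz1 t) i).1,
          fun i => (hcbox ε hε _ (hz1 t) i).2⟩).measurable.aestronglyMeasurable
    · filter_upwards [Ioo_mem_nhdsGT (zero_lt_one' ℝ)] with ε hε
      refine Filter.Eventually.of_forall fun t _ => ?_
      have hmem : c ε (z t) ∈ Set.Icc (0 : Fin s → ℝ) 1 :=
        ⟨fun i => hε.1.le.trans (hcbox ε hε _ (hz1 t) i).1,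
          fun i => (hcbox ε hε _ (hz1 t) i).2⟩
      have h0 := hg ⟨le_rfl, zero_le_one⟩ hmem hmem.1
      have h1 := hg hmem ⟨zero_le_one, le_rfl⟩ hmem.2
      rw [Real.norm_eq_abs, abs_le]
      constructor <;>
        linarith [neg_abs_le (g 0), le_abs_self (g 1), abs_nonneg (g 0), abs_nonneg (g 1)]
    · refine Filter.Eventually.of_forall fun t _ => ?_
      have hcont : Continuous fun ε => g (c ε (z t)) := hgcont.comp (by fun_prop)
      have h := hcont.tendsto 0
      have e : c 0 (z t) = z t := by
        ext i; simp [c]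
      simp only [e] at h
      exact h.mono_left nhdsWithin_le_nhds
  refine le_of_tendsto_of_tendsto (hlim x hx hx1) (hlim y hy hy1) ?_
  filter_upwards [Ioo_mem_nhdsGT (zero_lt_one' ℝ)] with ε hε
  refine integral_curve_le_of_pos hg hgc hgd hε.1 (hanti ε hε x hx) (hanti ε hε y hy)
    (fun t i => hcbox ε hε _ (hx1 t) i) (fun t i => hcbox ε hε _ (hy1 t) i) fun i t ht => ?_
  have hxi : Antitone fun u => x u i := fun _ _ h => hx h i
  have hyi : Antitone fun u => y u i := fun _ _ h => hy h i
  simp only [c]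
  rw [intervalIntegral.integral_add intervalIntegrable_const
      (hxi.intervalIntegrable.const_mul _),
    intervalIntegral.integral_add intervalIntegrable_const
      (hyi.intervalIntegrable.const_mul _), intervalIntegral.integral_const_mul,
    intervalIntegral.integral_const_mul]
  exact add_le_add_right (mul_le_mul_of_nonneg_left (hxy i t ht) (by linarith [hε.2])) _

end Curves

/-! ### Stop-loss functions and the increasing convex order. -/

section StopLoss

variable {Ω : Type*} [MeasurableSpace Ω] {Q : Measure Ω} [IsProbabilityMeasure Q]

/-- Turns the increasing convex order, tested on `max (x - t) 0`, into an order of tail integrals of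
survival functions. -/
theorem Loss.integral_sub_pos_part (X : Loss Ω) {t : ℝ} (ht : t ∈ Set.Icc (0 : ℝ) 1) :
    ∫ ω, max (X ω - t) 0 ∂Q = ∫ u in t..1, Q.real (X.above u) := by
  have hφ : Monotone fun x : ℝ => max (x - t) 0 := fun x y h => max_le_max (by linarith) le_rfl
  rw [(X.integrable_comp_monotone hφ).integral_eq_integral_meas_lt
    (Filter.Eventually.of_forall fun ω => le_max_right _ _)]
  have e1 : ∀ r ∈ Set.Ioi (0 : ℝ), Q.real {ω | r < max (X ω - t) 0} = Q.real (X.above (r + t)) := by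
    intro r hr
    congr 1
    ext ω
    have hr' : 0 < r := hr
    simp only [Set.mem_ofPred_eq, Loss.mem_above, lt_max_iff]
    constructor
    · rintro (h | h) <;> linarith
    · intro h; left; linarith
  rw [setIntegral_congr_fun measurableSet_Ioi e1]
  have e2 : ∫ r in Set.Ioi (0 : ℝ), Q.real (X.above (r + t)) =
      ∫ r in Set.Ioc (0 : ℝ) (1 - t), Q.real (X.above (r + t)) := by
    refine setIntegral_eq_of_subset_of_forall_sdiff_eq_zero measurableSet_Ioi
      Set.Ioc_subset_Ioi_self fun r hr => ?_
    have hr1 : 1 - t < r := by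
      by_contra h
      exact hr.2 ⟨hr.1, not_lt.1 h⟩
    rw [X.above_eq_empty (by linarith), measureReal_empty]
  rw [e2, ← intervalIntegral.integral_of_le (by linarith [ht.2]),
    intervalIntegral.integral_comp_add_right (fun u => Q.real (X.above u)), zero_add, sub_add_cancel]

theorem IcxLE.integral_above_le {X Y : Loss Ω} (h : IcxLE Q X Y) {t : ℝ}
    (ht : t ∈ Set.Icc (0 : ℝ) 1) :
    ∫ u in t..1, Q.real (X.above u) ≤ ∫ u in t..1, Q.real (Y.above u) := by
  have hφ : Monotone fun x : ℝ => max (x - t) 0 := fun x y h => max_le_max (by linarith) le_rfl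
  have hφc : ConvexOn ℝ Set.univ fun x : ℝ => max (x - t) 0 :=
    ((convexOn_id convex_univ).sub (concaveOn_const t convex_univ)).sup
      (convexOn_const (0 : ℝ) convex_univ)
  rw [← X.integral_sub_pos_part ht, ← Y.integral_sub_pos_part ht]
  exact h _ hφ hφc

end StopLoss

theorem IsSDistortionFunction.sRiskAverse {Ω : Type*} [MeasurableSpace Ω] {P : Measure Ω}
    [IsProbabilityMeasure P] {s : ℕ} {S : Fin s → Set Ω} {n : ℕ} {I : RatingCriterion Ω n}
    {ρ : BddRV Ω → ℝ} (hS : IsScenarios P S) (hρ : IsChoquetRepresentation I ρ)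
    {g : (Fin s → ℝ) → ℝ} (hg : IsSDistortionFunction P S ρ g) (hgcont : Continuous g)
    (hgc : ComponentwiseConcave g) (hgs : Submodular g) : SRiskAverse P S I := by
  have hprob := hS.isProbabilityMeasure_cond
  intro X Y h
  refine hρ.rate_le_of_rho_le ?_
  have hcap := hg.isCapacity hS
  rw [hg.repr, hg.repr, hcap.choquet_toBdd X le_rfl, hcap.choquet_toBdd Y le_rfl]
  exact integral_curve_le hg.mono hgc hgs.decreasingDifferences hgcont
    (fun t t' htt => scenarioProb_mono hS (X.above_anti htt))
    (fun t t' htt => scenarioProb_mono hS (Y.above_anti htt))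
    (fun t => scenarioProb_mem_Icc hS _) (fun t => scenarioProb_mem_Icc hS _)
    fun j t ht => (h j).integral_above_le ht

end ChoquetRating

theorem proposition3 {Ω : Type*} [MeasurableSpace Ω] (P : Measure Ω) [IsProbabilityMeasure P]
    (hP : IsAtomless P)
    {s : ℕ} (hs : 1 ≤ s) (S : Fin s → Set Ω) (hS : IsScenarios P S)
    {n : ℕ} (hn : 2 ≤ n) (I : RatingCriterion Ω n)
    (ρ : BddRV Ω → ℝ) (hρ : IsChoquetRepresentation I ρ)
    (hLI : SLawInvariant P S I) (hLC : LebesgueContinuous P ρ) :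
    List.TFAE
      [QuasiConvex I,
       SRiskAverse P S I,
       SPoolingEffect P S I,
       ∃ g : (Fin s → ℝ) → ℝ,
        IsSDistortionFunction P S ρ g ∧ ComponentwiseConcave g ∧ Submodular g] := by
  -- A uniform variable and an independent sequence of coins, with the same joint law in every
  -- scenario.
  obtain ⟨V, hV, hVP⟩ := hS.exists_measurable_map_eq hP
    ((volume : Measure unitInterval).prod uniformSeq)
  have hU := isUniform_fst hV hVP
  obtain ⟨ν, hν, hρν⟩ := hρ.exists_capacity
  have hg := hS.isSDistortionFunction_lower hU hρ hLI hν hρν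
  have hgc := hS.continuous_lower hU hν hρν hLC
  have of_local : LocallyDecreasing (fun x => ν (hS.lower (fun ω => (V ω).1) x)) →
      ∃ g : (Fin s → ℝ) → ℝ,
        IsSDistortionFunction P S ρ g ∧ ComponentwiseConcave g ∧ Submodular g := fun h =>
    ⟨_, hg, h.componentwiseConcave hgc, h.submodular hgc⟩
  tfae_have 1 → 4 := fun h => of_local <|
    hS.locallyDecreasing_lower hU hρ hLI hν hρν fun _ _ hA hB =>
      h.submodular_capacity hρ hν hρν hA hB
  tfae_have 4 → 1 := fun ⟨_, h, hc, hsub⟩ =>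
    h.quasiConvex hS hρ (hsub.decreasingDifferences.decreasingIncrements hc)
  tfae_have 4 → 2 := by
    rintro ⟨g', h, hc, hsub⟩
    -- The given `g'` is replaced by the canonical distortion function, which is continuous on the
    -- whole space.
    have heq : Set.EqOn g' (fun x => ν (hS.lower (fun ω => (V ω).1) x)) (Set.Icc 0 1) :=
      fun x hx => h.eq_lower hS hU hν hρν hx
    exact hg.sRiskAverse hS hρ hgc (hc.congr heq) (hsub.congr heq)
  tfae_have 2 → 3 := fun h => h.sPoolingEffect hS
  tfae_have 3 → 4 := fun h => of_local <|
    h.locallyDecreasing_lower hS hρ hLI hν hρν hV hVP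
  tfae_finish
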